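/- Consider the system $x_{t+1}=Ax_t+Bu_t$, $y_t=Cx_t+v_t$, $x_0=0$, with $A\in\mathbb R^{n\times n}$, $B\in\mathbb R^{n\times d_u}$, $C\in\mathbb R^{d_y\times n}$. Let the eigenvalues of $A$, with multiplicity, satisfy $|\lambda_1|\ge\dots\ge|\lambda_k|>1>|\lambda_{k+1}|\ge\dots\ge|\lambda_n|$, where $1\le k<n$. Let $$A=[Q_1\ Q_2]\begin{bmatrix}N_1&0\\0&N_2\end{bmatrix}\begin{bmatrix}R_1\\R_2\end{bmatrix},\qquad \begin{bmatrix}R_1\\R_2\end{bmatrix}=[Q_1\ Q_2]^{-1},$$ where $Q_1$ and $Q_2$ have orthonormal columns, $N_1$ has eigenvalues $\lambda_1,\dots,\lambda_k$ and $N_2$ has eigenvalues $\lambda_{k+1},\dots,\lambda_n$. Let $m\ge 0$ and $p,q\ge1$ be integers and put $T=m+p+q+2$. Let $H$ and $\tilde H$ be the $p\times q$ block matrices with $(i,j)$ blocks $H_{ij}=CA^{m+i+j-2}B$ and $\tilde H_{ij}=CQ_1N_1^{m+i+j-2}R_1B$. ($\tilde H$ is the product of the block column with blocks $CQ_1N_1^{m/2+i-1}$,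 $i\le p$, and the block row with blocks $N_1^{m/2+j-1}R_1B$, $j\le q$.) Data: $M$ rollouts of length $T$ are observed, with inputs $u^{(i)}_t\sim\mathcal N(0,\sigma_u^2I)$ and noises $v^{(i)}_t\sim\mathcal N(0,\sigma_v^2I)$, $0\le t<T$, all independent, where $\sigma_u,\sigma_v>0$. Let $y^{(i)}=[y^{(i)}_0\cdots y^{(i)}_{T-1}]$, and let $U^{(i)}$ be the $T\times T$ block matrix whose block in row $r$ and column $t$ ($0\le r,t<T$) is $u^{(i)}_{t-r}$ if $r\le t$ and $0$ otherwise. Let $\hat\Phi=[\hat\Phi_1\cdots\hat\Phi_T]$, with blocks in $\mathbb R^{d_y\times d_u}$, be any minimizer of $X\mapsto\sum_{i=1}^M\|y^{(i)}-XU^{(i)}\|_F^2$. Let $\hat H$ be the $p\times q$ block matrix with blocks $\hat H_{ij}=\hat\Phi_{m+i+j}$, and let $\hat{\tilde H}$ be obtained from a singular value decomposition of $\hat H$ by keeping only the top $k$ singular values and their singular vectors. Let $\|\cdot\|$ be the spectral norm, and let $L$ be a constant with $\|B\|,\|C\|,\|R_1B\|\le L$ and $\|N_2^t\|\le L\big(\tfrac{|\lambda_{k+1}|+1}{2}\big)^t$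 for all integers $t\ge0$. Suppose also that $p\ge4$ or $\|R_2B\|\le L$. Let $\delta\in(0,1)$ and $M>8d_uT+4(d_u+d_y+4)\log(3T/\delta)$. Put $$\hat\epsilon=\frac{8\sigma_v\sqrt{T(T+1)(d_u+d_y)\min\{p,q\}\log(27T/\delta)}}{\sigma_u\sqrt M},\qquad \tilde\epsilon=\sqrt q\,p\,L^3\Big(\frac{|\lambda_{k+1}|+1}{2}\Big)^m .$$ Then $\|H-\tilde H\|\le\tilde\epsilon$. Moreover, with probability at least $1-\delta$, $$\|H-\hat H\|\le\hat\epsilon\qquad\text{and}\qquad\|\hat{\tilde H}-\tilde H\|<2\hat\epsilon+2\tilde\epsilon .$$ -/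

import Mathlib

open MeasureTheory ProbabilityTheory
-- `‖X‖` for a matrix `X` is the spectral norm (largest singular value).
open scoped Matrix Matrix.Norms.L2Operator

noncomputable section

namespace LTI

/-- Length of a rollout. -/
abbrev rolloutLength (m p q : ℕ) : ℕ := m + p + q + 2

section System

variable {n du dy T : ℕ}

/-- State of `x_{t+1} = A x_t + B u_t`, started at `x_0 = 0`, for an input sequence of length `T`
(the value after time `T` is irrelevant). -/
def state (A : Matrix (Fin n) (Fin n) ℝ) (B : Matrix (Fin n) (Fin du) ℝ)
    (u : Fin T → Fin du → ℝ) : ℕ → Fin n → ℝ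
  | 0 => 0
  | t + 1 => A *ᵥ state A B u t + B *ᵥ (if h : t < T then u ⟨t, h⟩ else 0)

/-- Outputs `y_t = C x_t + v_t` of one rollout, as the matrix `[y_0 y_1 … y_{T-1}]`. -/
def outputs (A : Matrix (Fin n) (Fin n) ℝ) (B : Matrix (Fin n) (Fin du) ℝ)
    (C : Matrix (Fin dy) (Fin n) ℝ) (u : Fin T → Fin du → ℝ) (v : Fin T → Fin dy → ℝ) :
    Matrix (Fin dy) (Fin T) ℝ :=
  Matrix.of fun a t => (C *ᵥ state A B u t + v t) a

/-- Upper-triangular block Toeplitz matrix of the inputs: the block in row `r` and column `t`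
is the column vector `u_{t-r}` if `r ≤ t`, and `0` otherwise. -/
def inputToeplitz (u : Fin T → Fin du → ℝ) : Matrix (Fin T × Fin du) (Fin T) ℝ :=
  Matrix.of fun rb t =>
    if rb.1 ≤ t then u ⟨(t : ℕ) - (rb.1 : ℕ), lt_of_le_of_lt (Nat.sub_le _ _) t.isLt⟩ rb.2 else 0

/-- `∑ i, ‖y⁽ⁱ⁾ - X U⁽ⁱ⁾‖_F²`. -/
def squaredResidual {M : ℕ} (y : Fin M → Matrix (Fin dy) (Fin T) ℝ)
    (U : Fin M → Matrix (Fin T × Fin du) (Fin T) ℝ) (X : Matrix (Fin dy) (Fin T × Fin du) ℝ) : ℝ :=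
  ∑ i, ∑ a, ∑ t, ((y i - X * U i) a t) ^ 2

/-- `X` is a solution of the ordinary least-squares problem
`argmin_X ∑ i, ‖y⁽ⁱ⁾ - X U⁽ⁱ⁾‖_F²` for the data of the `M` rollouts. -/
def IsLeastSquares {M : ℕ} (A : Matrix (Fin n) (Fin n) ℝ) (B : Matrix (Fin n) (Fin du) ℝ)
    (C : Matrix (Fin dy) (Fin n) ℝ) (u : Fin M → Fin T → Fin du → ℝ)
    (v : Fin M → Fin T → Fin dy → ℝ) (X : Matrix (Fin dy) (Fin T × Fin du) ℝ) : Prop :=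
  ∀ X' : Matrix (Fin dy) (Fin T × Fin du) ℝ,
    squaredResidual (fun i => outputs A B C (u i) (v i)) (fun i => inputToeplitz (u i)) X ≤
      squaredResidual (fun i => outputs A B C (u i) (v i)) (fun i => inputToeplitz (u i)) X'

end System

section Hankel

variable {n k du dy : ℕ}

/-- Lifted Hankel matrix; with zero-based block indices its `(i, j)` block is `C A^{m+i+j} B`. -/
def hankel (A : Matrix (Fin n) (Fin n) ℝ) (B : Matrix (Fin n) (Fin du) ℝ)
    (C : Matrix (Fin dy) (Fin n) ℝ) (m p q : ℕ) :
    Matrix (Fin p × Fin dy) (Fin q × Fin du) ℝ :=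
  Matrix.of fun ia jb => (C * A ^ (m + (ia.1 : ℕ) + (jb.1 : ℕ)) * B) ia.2 jb.2

/-- Lifted Hankel matrix built from a block row `Φ = [Φ_0 Φ_1 … Φ_{T-1}]`, in which `Φ_{ℓ+1}`
stands for `C A^ℓ B` (and `Φ_0` for the feedthrough term): the `(i, j)` block is `Φ_{m+i+j+1}`. -/
def hankelOfMarkov (m p q : ℕ) (Φ : Matrix (Fin dy) (Fin (rolloutLength m p q) × Fin du) ℝ) :
    Matrix (Fin p × Fin dy) (Fin q × Fin du) ℝ :=
  Matrix.of fun ia jb =>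
    Φ ia.2 (⟨m + (ia.1 : ℕ) + (jb.1 : ℕ) + 1, by
      have h1 := ia.1.isLt
      have h2 := jb.1.isLt
      show m + (ia.1 : ℕ) + (jb.1 : ℕ) + 1 < m + p + q + 2
      omega⟩, jb.2)

/-- Block column with blocks `C₁ N₁^{m/2+i}`, `i < p` (for odd `m` the exponent `m/2` is
rounded down here, and up in `conTilde`, so that the product below is the same for all `m`). -/
def obsTilde (C₁ : Matrix (Fin dy) (Fin k) ℝ) (N₁ : Matrix (Fin k) (Fin k) ℝ) (m p : ℕ) :
    Matrix (Fin p × Fin dy) (Fin k) ℝ :=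
  Matrix.of fun ia s => (C₁ * N₁ ^ (m / 2 + (ia.1 : ℕ))) ia.2 s

/-- Block row with blocks `N₁^{m/2+j} B₁`, `j < q`. -/
def conTilde (N₁ : Matrix (Fin k) (Fin k) ℝ) (B₁ : Matrix (Fin k) (Fin du) ℝ) (m q : ℕ) :
    Matrix (Fin k) (Fin q × Fin du) ℝ :=
  Matrix.of fun s jb => (N₁ ^ (m - m / 2 + (jb.1 : ℕ)) * B₁) s jb.2

/-- The rank-`k` approximation of the lifted Hankel matrix by the unstable subsystem
`(N₁, B₁, C₁) = (N₁, R₁ B, C Q₁)`. -/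
def hankelTilde (C₁ : Matrix (Fin dy) (Fin k) ℝ) (N₁ : Matrix (Fin k) (Fin k) ℝ)
    (B₁ : Matrix (Fin k) (Fin du) ℝ) (m p q : ℕ) :
    Matrix (Fin p × Fin dy) (Fin q × Fin du) ℝ :=
  obsTilde C₁ N₁ m p * conTilde N₁ B₁ m q

end Hankel

/-- `K` is obtained from a singular value decomposition `H = U Σ Vᵀ` (orthonormal columns in `U`
and `V`, nonnegative nonincreasing diagonal `s` of `Σ`) by keeping only the top `k` singular values
with their singular vectors. -/
def IsTruncatedSVD {ι κ : Type*} [Fintype ι] [Fintype κ] (k : ℕ) (H K : Matrix ι κ ℝ) : Prop :=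
  ∃ (r : ℕ) (U : Matrix ι (Fin r) ℝ) (V : Matrix κ (Fin r) ℝ) (s : Fin r → ℝ),
    Uᵀ * U = 1 ∧ Vᵀ * V = 1 ∧ Antitone s ∧ (∀ i, 0 ≤ s i) ∧
    H = U * Matrix.diagonal s * Vᵀ ∧
    K = U * Matrix.diagonal (fun i : Fin r => if (i : ℕ) < k then s i else 0) * Vᵀ

/-- `lam 0, …, lam (n-1)` are the eigenvalues of `A` with algebraic multiplicity, ordered by
nonincreasing modulus; exactly the first `k` have modulus `> 1`, and the others have
modulus `< 1`. -/
structure IsOrderedSpectrum {n : ℕ} (A : Matrix (Fin n) (Fin n) ℝ) (k : ℕ)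
    (lam : Fin n → ℂ) : Prop where
  charpoly_eq : (A.map ((↑) : ℝ → ℂ)).charpoly = ∏ i, (Polynomial.X - Polynomial.C (lam i))
  antitone : Antitone fun i => ‖lam i‖
  unstable : ∀ i : Fin n, (i : ℕ) < k → 1 < ‖lam i‖
  stable : ∀ i : Fin n, k ≤ (i : ℕ) → ‖lam i‖ < 1

/-- `A = [Q₁ Q₂] diag(N₁, N₂) [R₁; R₂]` with `[R₁; R₂] = [Q₁ Q₂]⁻¹`, where `Q₁` and `Q₂` have
orthonormal columns (bases of the two invariant subspaces), `N₁` has the first `k` eigenvalues of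
`A` and `N₂` has the others. -/
structure IsStabilityDecomposition {n k : ℕ} (A : Matrix (Fin n) (Fin n) ℝ) (lam : Fin n → ℂ)
    (Q₁ : Matrix (Fin n) (Fin k) ℝ) (Q₂ : Matrix (Fin n) (Fin (n - k)) ℝ)
    (R₁ : Matrix (Fin k) (Fin n) ℝ) (R₂ : Matrix (Fin (n - k)) (Fin n) ℝ)
    (N₁ : Matrix (Fin k) (Fin k) ℝ) (N₂ : Matrix (Fin (n - k)) (Fin (n - k)) ℝ) : Prop where
  decomp : A = Matrix.fromCols Q₁ Q₂ * Matrix.fromBlocks N₁ 0 0 N₂ * Matrix.fromRows R₁ R₂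
  left_inv : Matrix.fromRows R₁ R₂ * Matrix.fromCols Q₁ Q₂ = 1
  right_inv : Matrix.fromCols Q₁ Q₂ * Matrix.fromRows R₁ R₂ = 1
  orthonormal₁ : Q₁ᵀ * Q₁ = 1
  orthonormal₂ : Q₂ᵀ * Q₂ = 1
  charpoly₁ : (N₁.map ((↑) : ℝ → ℂ)).charpoly =
    ∏ i ∈ Finset.univ.filter (fun i : Fin n => (i : ℕ) < k), (Polynomial.X - Polynomial.C (lam i))
  charpoly₂ : (N₂.map ((↑) : ℝ → ℂ)).charpoly =
    ∏ i ∈ Finset.univ.filter (fun i : Fin n => k ≤ (i : ℕ)), (Polynomial.X - Polynomial.C (lam i))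

/-- The input coordinates are `N(0, σu²)`, the noise coordinates are `N(0, σv²)`, and all of them,
over all rollouts and times, are independent. -/
structure IsGaussianData {Ω : Type*} [MeasurableSpace Ω] (P : Measure Ω) {M T du dy : ℕ}
    (σu σv : ℝ) (u : Fin M → Fin T → Fin du → Ω → ℝ) (v : Fin M → Fin T → Fin dy → Ω → ℝ) :
    Prop where
  law_u : ∀ i t a, HasLaw (u i t a) (gaussianReal 0 (σu ^ 2).toNNReal) P
  law_v : ∀ i t a, HasLaw (v i t a) (gaussianReal 0 (σv ^ 2).toNNReal) P
  indep : iIndepFun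
    (Sum.elim (fun x : Fin M × Fin T × Fin du => u x.1 x.2.1 x.2.2)
      (fun x : Fin M × Fin T × Fin dy => v x.1 x.2.1 x.2.2)) P

/-- Least-squares error level
`8 σv √(T(T+1)(du+dy) min{p,q} log(27T/δ)) / (σu √M)`, with `T = m + p + q + 2`. -/
def epsHat (σu σv : ℝ) (du dy m p q M : ℕ) (δ : ℝ) : ℝ :=
  8 * σv * Real.sqrt ((rolloutLength m p q : ℝ) * ((rolloutLength m p q : ℝ) + 1) *
      ((du : ℝ) + dy) * (min p q : ℕ) * Real.log (27 * (rolloutLength m p q : ℝ) / δ)) /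
    (σu * Real.sqrt M)

/-- Error level `√q p L³ ((r + 1)/2)^m` of the rank-`k` unstable approximation, where `r` is the
largest modulus of a stable eigenvalue. -/
def epsTilde (L r : ℝ) (m p q : ℕ) : ℝ :=
  Real.sqrt q * p * L ^ 3 * ((r + 1) / 2) ^ m

end LTI

end

/-! The deterministic bound comes from `A ^ l = Q₁ N₁ ^ l R₁ + Q₂ N₂ ^ l R₂`: each block of `H - H̃`
is `C Q₂ N₂ ^ (m+i+j) R₂ B`, of norm at most `L² ρ^m ‖R₂ B‖` with `ρ = (|λ_{k+1}| + 1)/2`, and a `p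
× q` array of such blocks costs a factor `√(pq)` (`norm_block_le`). Orthonormality gives `‖R₂ B‖ ≤
‖B‖ + ‖R₁ B‖ ≤ 2L`, and the 2 is absorbed by `√p` when `p ≥ 4`.

For the estimate, let `D` be the error in the Markov parameters. Testing the normal equations with
the rank-one matrix `a xᵀ`, where `x = Dᵀ a`, gives `‖w‖² = ⟨noise, a ⊗ w⟩` for the signal `w` that
the regressors generate from `x`. Two events then bound `D` (`norm_sub_markov_le`). (1) The inputs
are well conditioned: `‖w‖² ≥ (M σu² / 16) ‖x‖²`. Only the last column of each Toeplitz matrix is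
needed; these columns form `M` independent Gaussian rows of length `T du`, handled by Chernoff
bounds on nets (`measure_rows_lower_bound`). (2) The noise satisfies `⟨noise, a ⊗ w⟩ ≤ 2 s σv ‖a‖
‖w‖` for all `w` in the range of the regressors. Once the inputs are fixed this range is a fixed
space of dimension at most `T du`, so quarter-nets with at most `9 ^ (dy + T du)` pairs and a
Gaussian tail suffice (`measure_noise_bound`); Fubini removes the conditioning. Together `‖D‖ ≤ 8 s
σv / (σu √M)`. Every block row of the Hankel error is a submatrix of `D`, so passing to `H - Ĥ`
costs `√p`, which the factor `T(T+1)` in `ε̂` absorbs.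

Finally, `H̃` factors through dimension `k`, so the truncation is at least as close to `Ĥ` as `H̃`
is (Eckart–Young), and its distance to `H̃` is at most `2 ‖Ĥ - H̃‖`. -/

noncomputable section

namespace LTI

/-! ### Nets on unit spheres -/

section Nets

open Module Metric

variable {E : Type*} [NormedAddCommGroup E] [NormedSpace ℝ E]

/-- Volume bound on the cardinality of an `ε`-separated subset of the unit sphere. -/
theorem card_le_of_separated_sphere [FiniteDimensional ℝ E] {ε : ℝ} (hε : 0 < ε) (s : Finset E)
    (hs : ∀ c ∈ s, ‖c‖ = 1)
    (h : ∀ c ∈ s, ∀ d ∈ s, c ≠ d → ε ≤ ‖c - d‖) :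
    (s.card : ℝ) ≤ (1 + 2 / ε) ^ finrank ℝ E := by
  borelize E
  let μ : Measure E := Measure.addHaar
  have hε2 : 0 < ε / 2 := by positivity
  have hρ : 0 < 1 + ε / 2 := by positivity
  have D : Set.Pairwise (s : Set E) (Function.onFun Disjoint fun c => ball (c : E) (ε / 2)) := by
    rintro c hc d hd hcd
    apply ball_disjoint_ball
    rw [dist_eq_norm]
    have := h c hc d hd hcd
    linarith
  have hsub : (⋃ c ∈ s, ball (c : E) (ε / 2)) ⊆ ball (0 : E) (1 + ε / 2) := by
    refine Set.iUnion₂_subset fun x hx => ball_subset_ball' ?_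
    rw [dist_zero_right, hs x hx, add_comm]
  have I : (s.card : ENNReal) * ENNReal.ofReal ((ε / 2) ^ finrank ℝ E) * μ (ball 0 1) ≤
      ENNReal.ofReal ((1 + ε / 2) ^ finrank ℝ E) * μ (ball 0 1) := by
    calc
      _ = μ (⋃ c ∈ s, ball (c : E) (ε / 2)) := by
        rw [measure_biUnion_finset D fun c _ => measurableSet_ball]
        simp only [μ.addHaar_ball_of_pos _ hε2]
        simp only [Finset.sum_const, nsmul_eq_mul, mul_assoc]
      _ ≤ μ (ball (0 : E) (1 + ε / 2)) := measure_mono hsub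
      _ = _ := by simp only [μ.addHaar_ball_of_pos _ hρ]
  have J := (ENNReal.mul_le_mul_iff_left (measure_ball_pos μ _ zero_lt_one).ne'
    measure_ball_lt_top.ne).1 I
  have K := ENNReal.toReal_le_of_le_ofReal (pow_nonneg hρ.le _) J
  rw [ENNReal.toReal_mul, ENNReal.toReal_natCast, ENNReal.toReal_ofReal (by positivity)] at K
  have e : (1 + 2 / ε) = (1 + ε / 2) / (ε / 2) := by field_simp; ring
  rw [e, div_pow, le_div_iff₀ (by positivity)]
  exact K

/-- A separated set of maximal cardinality is a net, since an uncovered point could be added to it;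
the volume bound guarantees that a maximum exists. -/
theorem exists_sphere_net (E : Type*) [NormedAddCommGroup E] [NormedSpace ℝ E]
    [FiniteDimensional ℝ E] {ε : ℝ} (hε : 0 < ε) :
    ∃ N : Finset E, (∀ y ∈ N, ‖y‖ = 1) ∧ (N.card : ℝ) ≤ (1 + 2 / ε) ^ finrank ℝ E ∧
      ∀ x : E, ‖x‖ = 1 → ∃ y ∈ N, ‖x - y‖ ≤ ε := by
  classical
  let P : ℕ → Prop := fun k => ∃ s : Finset E, (∀ c ∈ s, ‖c‖ = 1) ∧
    (∀ c ∈ s, ∀ d ∈ s, c ≠ d → ε ≤ ‖c - d‖) ∧ s.card = k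
  have hbd : ∀ k, P k → k ≤ ⌊(1 + 2 / ε) ^ finrank ℝ E⌋₊ := by
    rintro k ⟨s, h1, h2, rfl⟩
    exact Nat.le_floor (card_le_of_separated_sphere hε s h1 h2)
  have h0 : P 0 := ⟨∅, by simp⟩
  obtain ⟨s, h1, h2, h3⟩ := Nat.findGreatest_spec (P := P)
    (Nat.zero_le ⌊(1 + 2 / ε) ^ finrank ℝ E⌋₊) h0
  refine ⟨s, h1, card_le_of_separated_sphere hε s h1 h2, fun x hx => ?_⟩
  by_contra! hcon
  have hxs : x ∉ s := fun hxs => by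
    have := hcon x hxs
    simp at this
    linarith
  have hP : P (s.card + 1) := by
    refine ⟨insert x s, ?_, ?_, Finset.card_insert_of_notMem hxs⟩
    · intro c hc
      rcases Finset.mem_insert.1 hc with rfl | hc
      exacts [hx, h1 c hc]
    · intro c hc d hd hcd
      rcases Finset.mem_insert.1 hc with rfl | hc' <;> rcases Finset.mem_insert.1 hd with rfl | hd'
      · exact absurd rfl hcd
      · exact (hcon d hd').le
      · rw [norm_sub_rev]; exact (hcon c hc').le
      · exact h2 c hc' d hd' hcd
  have := Nat.le_findGreatest (P := P) (m := s.card + 1) (hbd (s.card + 1) hP) hP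
  omega

variable {F : Type*} [NormedAddCommGroup F] [NormedSpace ℝ F]

/-- Approximation by the net gives `‖f‖ ≤ b + ε ‖f‖`, which is solved for `‖f‖`. -/
theorem opNorm_le_of_net (f : E →L[ℝ] F) {N : Finset E} {ε b : ℝ} (hε : ε < 1) (hb : 0 ≤ b)
    (hN : ∀ x : E, ‖x‖ = 1 → ∃ y ∈ N, ‖x - y‖ ≤ ε) (h : ∀ y ∈ N, ‖f y‖ ≤ b) (hε0 : 0 ≤ ε) :
    ‖f‖ ≤ b / (1 - ε) := by
  have h1 : ‖f‖ ≤ b + ε * ‖f‖ := by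
    refine f.opNorm_le_of_unit_norm (by positivity) fun x hx => ?_
    obtain ⟨y, hy, hxy⟩ := hN x hx
    calc ‖f x‖ = ‖f y + f (x - y)‖ := by rw [map_sub, add_sub_cancel]
      _ ≤ ‖f y‖ + ‖f (x - y)‖ := norm_add_le _ _
      _ ≤ b + ‖f‖ * ‖x - y‖ := add_le_add (h y hy) (f.le_opNorm _)
      _ ≤ b + ε * ‖f‖ := by rw [mul_comm ε]; gcongr
  rw [le_div_iff₀ (by linarith)]
  linarith

/-- A bilinear form is controlled on the product of the unit spheres by its (one-sided) values on
quarter-nets. -/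
theorem bilin_le_of_net (f : E →L[ℝ] F →L[ℝ] ℝ) {N : Finset E} {N' : Finset F} {b : ℝ}
    (hb : 0 ≤ b) (hN' : ∀ y ∈ N', ‖y‖ = 1)
    (hN : ∀ x : E, ‖x‖ = 1 → ∃ y ∈ N, ‖x - y‖ ≤ 1 / 4)
    (hN'c : ∀ x : F, ‖x‖ = 1 → ∃ y ∈ N', ‖x - y‖ ≤ 1 / 4)
    (h : ∀ y ∈ N, ∀ y' ∈ N', f y y' ≤ b) (x : E) (x' : F) :
    f x x' ≤ 2 * b * ‖x‖ * ‖x'‖ := by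
  have key : ∀ x : E, ‖x‖ = 1 → ∀ x' : F, ‖x'‖ = 1 → f x x' ≤ b + ‖f‖ / 2 := by
    intro x hx x' hx'
    obtain ⟨y, hy, hxy⟩ := hN x hx
    obtain ⟨y', hy', hxy'⟩ := hN'c x' hx'
    -- Each of the two error terms costs `‖f‖ / 4`, whence `‖f‖ ≤ b + ‖f‖ / 2`.
    have e : f x x' = f y y' + f x (x' - y') + f (x - y) y' := by
      simp only [map_sub, sub_apply]
      ring
    have h1 : f x (x' - y') ≤ ‖f‖ * (1 / 4) := by
      calc f x (x' - y') ≤ ‖f x (x' - y')‖ := le_abs_self _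
        _ ≤ ‖f‖ * ‖x‖ * ‖x' - y'‖ := f.le_opNorm₂ _ _
        _ ≤ ‖f‖ * 1 * (1 / 4) := by rw [hx]; gcongr
        _ = _ := by ring
    have h2 : f (x - y) y' ≤ ‖f‖ * (1 / 4) := by
      calc f (x - y) y' ≤ ‖f (x - y) y'‖ := le_abs_self _
        _ ≤ ‖f‖ * ‖x - y‖ * ‖y'‖ := f.le_opNorm₂ _ _
        _ ≤ ‖f‖ * (1 / 4) * 1 := by rw [hN' y' hy']; gcongr
        _ = _ := by ring
    have := h y hy y' hy'
    linarith
  have hf : ‖f‖ ≤ b + ‖f‖ / 2 := by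
    refine f.opNorm_le_of_unit_norm (by positivity) fun x hx => ?_
    refine (f x).opNorm_le_of_unit_norm (by positivity) fun x' hx' => ?_
    rw [Real.norm_eq_abs, abs_le]
    constructor
    -- One-sided bounds suffice because the sphere is symmetric.
    · have := key x hx (-x') (by rwa [norm_neg])
      rw [map_neg] at this
      linarith
    · exact key x hx x' hx'
  calc f x x' ≤ ‖f x x'‖ := le_abs_self _
    _ ≤ ‖f‖ * ‖x‖ * ‖x'‖ := f.le_opNorm₂ _ _
    _ ≤ 2 * b * ‖x‖ * ‖x'‖ := by gcongr; linarith

end Nets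

/-! ### Spectral norm through sums of squares -/

section OpNorm

variable {ι κ : Type*} [Fintype ι] [Fintype κ] [DecidableEq κ]

theorem sum_sq_mulVec_le (A : Matrix ι κ ℝ) (x : κ → ℝ) :
    ∑ i, ((A *ᵥ x) i) ^ 2 ≤ ‖A‖ ^ 2 * ∑ j, x j ^ 2 := by
  have h := A.l2_opNorm_mulVec (WithLp.toLp 2 x)
  have h2 := pow_le_pow_left₀ (norm_nonneg _) h 2
  rw [mul_pow, EuclideanSpace.real_norm_sq_eq, EuclideanSpace.real_norm_sq_eq] at h2
  exact h2

theorem opNorm_le_of_sum_sq (A : Matrix ι κ ℝ) {c : ℝ} (hc : 0 ≤ c)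
    (h : ∀ x : κ → ℝ, ∑ i, ((A *ᵥ x) i) ^ 2 ≤ c ^ 2 * ∑ j, x j ^ 2) : ‖A‖ ≤ c := by
  rw [Matrix.l2_opNorm_def]
  refine ContinuousLinearMap.opNorm_le_bound _ hc fun x => ?_
  refine le_of_sq_le_sq ?_ (by positivity)
  rw [mul_pow, EuclideanSpace.real_norm_sq_eq, EuclideanSpace.real_norm_sq_eq]
  exact h x.ofLp

end OpNorm

/-! ### Gaussian linear forms and Chernoff bounds -/

section Gaussian

open scoped NNReal

variable {ι κ : Type*} [Fintype ι] [Fintype κ]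

/-- Linear combinations of independent centered Gaussian coordinates are Gaussian. -/
theorem map_sum_mul_pi_gaussianReal (v : ℝ≥0) (x : κ → ℝ) :
    (Measure.pi fun _ : κ => gaussianReal 0 v).map (fun z => ∑ j, x j * z j) =
      gaussianReal 0 ((∑ j, x j ^ 2).toNNReal * v) := by
  set μ := Measure.pi fun _ : κ => gaussianReal 0 v with hμ
  have hlaw : ∀ j, HasLaw (fun z : κ → ℝ => z j) (gaussianReal 0 v) μ := fun j =>
    (measurePreserving_eval (fun _ : κ => gaussianReal 0 v) j).hasLaw
  have hind : iIndepFun (fun (j : κ) (z : κ → ℝ) => x j * z j) μ :=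
    iIndepFun_pi (X := fun j (y : ℝ) => x j * y) (fun j => by fun_prop)
  apply Measure.ext_of_charFun
  ext t
  have h := hind.charFun_map_sum_eq_prod
    (fun j => Measurable.aemeasurable (by fun_prop))
  have e : (∑ j, fun z : κ → ℝ => x j * z j) = fun z => ∑ j, x j * z j := by
    ext z; simp
  rw [e] at h
  have hS : 0 ≤ ∑ j, x j ^ 2 := Finset.sum_nonneg fun j _ => sq_nonneg _
  rw [h, Finset.prod_apply, charFun_gaussianReal]
  have h2 : ∀ j, μ.map (fun z => x j * z j) = gaussianReal 0 ((x j ^ 2).toNNReal * v) := by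
    intro j
    have := (gaussianReal_const_mul (hlaw j) (x j)).map_eq
    rw [Real.toNNReal_of_nonneg (sq_nonneg _)]
    simpa using this
  simp_rw [h2, charFun_gaussianReal, ← Complex.exp_sum]
  congr 1
  have h3 : (((∑ j, x j ^ 2).toNNReal : ℝ) : ℂ) = ∑ j, ((x j : ℂ)) ^ 2 := by
    rw [Real.coe_toNNReal _ hS]; push_cast; rfl
  have h4 : ∀ j, (((x j ^ 2).toNNReal : ℝ) : ℂ) = (x j : ℂ) ^ 2 := fun j => by
    rw [Real.coe_toNNReal _ (sq_nonneg _)]; push_cast; rfl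
  push_cast
  simp_rw [h4]
  rw [h3]
  simp only [mul_zero, zero_mul, zero_sub, Finset.sum_neg_distrib]
  rw [Finset.sum_mul, Finset.sum_mul, Finset.sum_div]

theorem integral_exp_mul_sq_gaussianReal {v : ℝ≥0} (hv : v ≠ 0) {t : ℝ} (ht : 2 * t * v < 1) :
    ∫ y, Real.exp (t * y ^ 2) ∂(gaussianReal 0 v) = (Real.sqrt (1 - 2 * t * v))⁻¹ := by
  have hv' : (0 : ℝ) < v := by positivity
  rw [integral_gaussianReal_eq_integral_smul hv]
  have e : ∀ y : ℝ, gaussianPDFReal 0 v y • Real.exp (t * y ^ 2) =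
      (Real.sqrt (2 * Real.pi * v))⁻¹ * Real.exp (-((1 - 2 * t * v) / (2 * v)) * y ^ 2) := by
    intro y
    rw [gaussianPDFReal, smul_eq_mul, mul_assoc, ← Real.exp_add]
    congr 2
    field_simp
    ring
  simp_rw [e]
  rw [integral_const_mul, integral_gaussian, ← Real.sqrt_inv, ← Real.sqrt_inv,
    ← Real.sqrt_mul (by positivity)]
  congr 1
  have : 1 - 2 * t * v ≠ 0 := by linarith
  field_simp

/-- Moment generating function of `∑ i, ⟨z i, x⟩²` for independent Gaussian rows `z i` and a unit
vector `x`. -/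
theorem mgf_sum_sq_gaussian {v : ℝ≥0} (hv : v ≠ 0) {x : κ → ℝ} (hx : ∑ j, x j ^ 2 = 1) {t : ℝ}
    (ht : 2 * t * v < 1) :
    mgf (fun z : ι → κ → ℝ => ∑ i, (∑ j, x j * z i j) ^ 2)
      (Measure.pi fun _ : ι => Measure.pi fun _ : κ => gaussianReal 0 v) t =
      (Real.sqrt (1 - 2 * t * v))⁻¹ ^ Fintype.card ι := by
  rw [mgf]
  simp_rw [Finset.mul_sum, Real.exp_sum]
  rw [integral_fintype_prod_eq_prod
    (f := fun (_ : ι) (z : κ → ℝ) => Real.exp (t * (∑ j, x j * z j) ^ 2))]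
  have h : ∫ z : κ → ℝ, Real.exp (t * (∑ j, x j * z j) ^ 2)
      ∂(Measure.pi fun _ : κ => gaussianReal 0 v) = (Real.sqrt (1 - 2 * t * v))⁻¹ := by
    have hm := map_sum_mul_pi_gaussianReal v x
    rw [hx, Real.toNNReal_one, one_mul] at hm
    rw [← integral_exp_mul_sq_gaussianReal hv ht]
    nth_rw 2 [← hm]
    rw [integral_map (Measurable.aemeasurable (by fun_prop)) (by fun_prop)]
  simp [h]

theorem integrable_exp_sum_sq_gaussian {v : ℝ≥0} (hv : v ≠ 0) {x : κ → ℝ}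
    (hx : ∑ j, x j ^ 2 = 1) {t : ℝ} (ht : 2 * t * v < 1) :
    Integrable (fun z : ι → κ → ℝ => Real.exp (t * ∑ i, (∑ j, x j * z i j) ^ 2))
      (Measure.pi fun _ : ι => Measure.pi fun _ : κ => gaussianReal 0 v) := by
  refine .of_integral_ne_zero ?_
  have h := mgf_sum_sq_gaussian (ι := ι) hv hx ht
  rw [mgf] at h
  rw [h]
  have : 0 < 1 - 2 * t * v := by linarith
  positivity

/-- Chernoff bound at `t = 1/(4v)`, where each row contributes a factor `√2` to the moment
generating function. -/
theorem measure_sum_sq_gaussian_ge {v : ℝ≥0} (hv : v ≠ 0) {x : κ → ℝ} (hx : ∑ j, x j ^ 2 = 1)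
    (a : ℝ) :
    (Measure.pi fun _ : ι => Measure.pi fun _ : κ => gaussianReal 0 v).real
      {z | a * Fintype.card ι * v ≤ ∑ i, (∑ j, x j * z i j) ^ 2} ≤
      Real.exp ((Real.log 2 / 2 - a / 4) * Fintype.card ι) := by
  have hv' : (0 : ℝ) < v := by positivity
  have ht : 2 * (1 / (4 * v)) * v < (1 : ℝ) := by field_simp; norm_num
  have h := measure_ge_le_exp_mul_mgf (a * Fintype.card ι * v)
    (by positivity : (0 : ℝ) ≤ 1 / (4 * v)) (integrable_exp_sum_sq_gaussian (ι := ι) hv hx ht)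
  refine h.trans_eq ?_
  rw [mgf_sum_sq_gaussian hv hx ht]
  have e : 1 - 2 * (1 / (4 * (v : ℝ))) * v = 2⁻¹ := by field_simp; norm_num
  rw [e, Real.sqrt_inv, inv_inv, Real.sqrt_eq_rpow, Real.rpow_def_of_pos two_pos,
    ← Real.exp_nat_mul, ← Real.exp_add]
  congr 1
  field_simp
  ring

/-- Chernoff bound at `t = -7/(2v)`, the optimal parameter for the threshold `1/8`: then `1 - 2tv =
8`, so each row contributes `8^(-1/2)`. -/
theorem measure_sum_sq_gaussian_le {v : ℝ≥0} (hv : v ≠ 0) {x : κ → ℝ} (hx : ∑ j, x j ^ 2 = 1) :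
    (Measure.pi fun _ : ι => Measure.pi fun _ : κ => gaussianReal 0 v).real
      {z | ∑ i, (∑ j, x j * z i j) ^ 2 ≤ 1 / 8 * Fintype.card ι * v} ≤
      Real.exp ((7 / 16 - 3 * Real.log 2 / 2) * Fintype.card ι) := by
  have hv' : (0 : ℝ) < v := by positivity
  have ht : 2 * (-(7 / (2 * v))) * v < (1 : ℝ) := by field_simp; norm_num
  have hneg : (-(7 / (2 * v)) : ℝ) ≤ 0 := neg_nonpos.2 (by positivity)
  have h := measure_le_le_exp_mul_mgf (1 / 8 * Fintype.card ι * v)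
    hneg (integrable_exp_sum_sq_gaussian (ι := ι) hv hx ht)
  refine h.trans_eq ?_
  rw [mgf_sum_sq_gaussian hv hx ht]
  have e : 1 - 2 * (-(7 / (2 * (v : ℝ)))) * v = 2 ^ (3 : ℝ) := by field_simp; norm_num
  rw [e, ← Real.sqrt_inv, Real.sqrt_eq_rpow, ← Real.rpow_neg two_pos.le, ← Real.rpow_mul two_pos.le,
    Real.rpow_def_of_pos two_pos, ← Real.exp_nat_mul, ← Real.exp_add]
  congr 1
  field_simp
  ring

/-- Gaussian tail of a normalized linear combination. -/
theorem measure_sum_mul_gaussian_ge {v : ℝ≥0} {x : κ → ℝ} (hx : ∑ j, x j ^ 2 = 1) {τ : ℝ}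
    (hτ : 0 ≤ τ) (hv : v ≠ 0) :
    (Measure.pi fun _ : κ => gaussianReal 0 v).real {z | τ * Real.sqrt v ≤ ∑ j, x j * z j} ≤
      Real.exp (-τ ^ 2 / 2) := by
  have hm := map_sum_mul_pi_gaussianReal v x
  rw [hx, Real.toNNReal_one, one_mul] at hm
  have hsub : HasSubgaussianMGF (fun z : κ → ℝ => ∑ j, x j * z j) v
      (Measure.pi fun _ : κ => gaussianReal 0 v) := by
    refine .of_map (Y := fun z : κ → ℝ => ∑ j, x j * z j) (X := id)
      (Measurable.aemeasurable (by fun_prop)) ?_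
    rw [hm]
    constructor
    · intro t
      exact integrable_exp_mul_gaussianReal t
    · intro t
      rw [mgf_id_gaussianReal]
      simp
  have h := hsub.measure_ge_le (ε := τ * Real.sqrt v) (by positivity)
  refine h.trans_eq ?_
  congr 1
  have hv' : (0 : ℝ) < v := by positivity
  rw [mul_pow, Real.sq_sqrt hv'.le]
  field_simp

end Gaussian

/-! ### Well-conditioned Gaussian rows and uniform noise control -/

section Concentration

open scoped NNReal

variable {ι κ : Type*} [Fintype ι] [Fintype κ]

theorem sum_sq_eq_one_of_norm {x : EuclideanSpace ℝ κ} (hx : ‖x‖ = 1) : ∑ j, x j ^ 2 = 1 := by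
  rw [← EuclideanSpace.real_norm_sq_eq, hx, one_pow]

open Classical in
/-- Multiplication by the matrix with rows `z i`, as a continuous linear map. -/
def rowsCLM (z : ι → κ → ℝ) : EuclideanSpace ℝ κ →L[ℝ] EuclideanSpace ℝ ι :=
  (Matrix.toLpLin 2 2 (Matrix.of z)).toContinuousLinearMap

theorem norm_rowsCLM_sq (z : ι → κ → ℝ) (x : EuclideanSpace ℝ κ) :
    ‖rowsCLM z x‖ ^ 2 = ∑ i, (∑ j, x j * z i j) ^ 2 := by
  classical
  rw [EuclideanSpace.real_norm_sq_eq]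
  refine Finset.sum_congr rfl fun i _ => ?_
  exact congrArg (· ^ 2) (Finset.sum_congr rfl fun j _ => mul_comm (z i j) (x j))

/-- If a matrix is not too large on a half-net and not too small on a `1/32`-net, then it is
bounded below on the whole space. -/
theorem rows_lower_bound_of_nets (z : ι → κ → ℝ) {c : ℝ} (hc : 0 ≤ c)
    {N N' : Finset (EuclideanSpace ℝ κ)}
    (hN : ∀ x : EuclideanSpace ℝ κ, ‖x‖ = 1 → ∃ y ∈ N, ‖x - y‖ ≤ 1 / 2)
    (hN' : ∀ x : EuclideanSpace ℝ κ, ‖x‖ = 1 → ∃ y ∈ N', ‖x - y‖ ≤ 1 / 32)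
    (hup : ∀ y ∈ N, ∑ i, (∑ j, y j * z i j) ^ 2 ≤ 64 / 25 * c)
    (hlow : ∀ y ∈ N', 1 / 8 * c ≤ ∑ i, (∑ j, y j * z i j) ^ 2) (x : κ → ℝ) :
    c / 16 * ∑ j, x j ^ 2 ≤ ∑ i, (∑ j, x j * z i j) ^ 2 := by
  set s := Real.sqrt c with hs
  have hs2 : s ^ 2 = c := Real.sq_sqrt hc
  have hs0 : 0 ≤ s := Real.sqrt_nonneg c
  -- `64/25 = (8/5)²`, and the half-net doubles the bound.
  have hop : ‖rowsCLM z‖ ≤ 16 / 5 * s := by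
    refine (opNorm_le_of_net (rowsCLM z) (b := 8 / 5 * s) (by norm_num) (by positivity) hN
      (fun y hy => ?_) (by norm_num)).trans_eq (by ring)
    refine le_of_sq_le_sq ?_ (by positivity)
    rw [norm_rowsCLM_sq]
    exact (hup y hy).trans_eq (by rw [mul_pow, hs2]; norm_num)
  have hunit : ∀ x : EuclideanSpace ℝ κ, ‖x‖ = 1 → s / 4 ≤ ‖rowsCLM z x‖ := by
    intro x hx
    obtain ⟨y, hy, hxy⟩ := hN' x hx
    -- `(7/20)² ≤ 1/8`. The perturbation below is `(16/5)/32 = 1/10`, leaving `7/20 - 1/10 = 1/4`,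
    -- which squares to the `1/16` of the conclusion.
    have h1 : 7 / 20 * s ≤ ‖rowsCLM z y‖ := by
      refine le_of_sq_le_sq ?_ (norm_nonneg _)
      rw [norm_rowsCLM_sq]
      refine le_trans ?_ (hlow y hy)
      rw [mul_pow, hs2]
      nlinarith
    have h2 : ‖rowsCLM z (x - y)‖ ≤ 16 / 5 * s * (1 / 32) :=
      ((rowsCLM z).le_opNorm _).trans (by gcongr)
    have h3 : ‖rowsCLM z y‖ - ‖rowsCLM z (x - y)‖ ≤ ‖rowsCLM z x‖ := by
      have : rowsCLM z y = rowsCLM z x - rowsCLM z (x - y) := by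
        rw [map_sub]; abel
      rw [this]
      linarith [norm_sub_le (rowsCLM z x) (rowsCLM z (x - y))]
    linarith
  set X : EuclideanSpace ℝ κ := WithLp.toLp 2 x with hX
  have hle : s / 4 * ‖X‖ ≤ ‖rowsCLM z X‖ := by
    rcases eq_or_ne X 0 with h0 | h0
    · simp [h0]
    · have hn : 0 < ‖X‖ := norm_pos_iff.2 h0
      have h := hunit (‖X‖⁻¹ • X) (by rw [norm_smul, norm_inv, norm_norm, inv_mul_cancel₀ hn.ne'])
      rw [map_smul, norm_smul, norm_inv, norm_norm, inv_mul_eq_div, le_div_iff₀ hn] at h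
      exact h
  have h := pow_le_pow_left₀ (by positivity) hle 2
  rw [norm_rowsCLM_sq, mul_pow, EuclideanSpace.real_norm_sq_eq, div_pow, hs2] at h
  norm_num at h
  exact h

/-- A Gaussian matrix with many more rows than columns is well conditioned. -/
theorem measure_rows_lower_bound {v : ℝ≥0} (hv : v ≠ 0) {l : ℝ} (hl : 0 ≤ l)
    (hM : 8 * (Fintype.card κ : ℝ) + 16 * l ≤ Fintype.card ι) :
    (Measure.pi fun _ : ι => Measure.pi fun _ : κ => gaussianReal 0 v).real
      {z | ¬ ∀ x : κ → ℝ, Fintype.card ι * v / 16 * ∑ j, x j ^ 2 ≤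
        ∑ i, (∑ j, x j * z i j) ^ 2} ≤ 2 * Real.exp (-l) := by
  set ν := Measure.pi fun _ : ι => Measure.pi fun _ : κ => gaussianReal 0 v
  obtain ⟨N, hN1, hNc, hN⟩ := exists_sphere_net (EuclideanSpace ℝ κ) (ε := 1 / 2) (by norm_num)
  obtain ⟨N', hN'1, hN'c, hN'⟩ := exists_sphere_net (EuclideanSpace ℝ κ) (ε := 1 / 32)
    (by norm_num)
  rw [finrank_euclideanSpace] at hNc hN'c
  set d := Fintype.card κ
  have hlog2 := Real.log_two_gt_d9
  have hlog2' := Real.log_two_lt_d9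
  have hd : (0 : ℝ) ≤ d := Nat.cast_nonneg _
  have hsub : {z : ι → κ → ℝ | ¬ ∀ x : κ → ℝ, Fintype.card ι * v / 16 * ∑ j, x j ^ 2 ≤
        ∑ i, (∑ j, x j * z i j) ^ 2} ⊆
      (⋃ y ∈ N, {z | 64 / 25 * Fintype.card ι * v ≤ ∑ i, (∑ j, y j * z i j) ^ 2}) ∪
      (⋃ y ∈ N', {z | ∑ i, (∑ j, y j * z i j) ^ 2 ≤ 1 / 8 * Fintype.card ι * v}) := by
    intro z hz
    by_contra hcon
    simp only [Set.mem_union, Set.mem_iUnion, Set.mem_ofPred_eq, not_or, not_exists, not_le] at hcon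
    refine hz (rows_lower_bound_of_nets z (by positivity) hN hN' (fun y hy => ?_) fun y hy => ?_)
    · exact (hcon.1 y hy).le.trans_eq (by ring)
    · exact (hcon.2 y hy).le.trans' (by rw [mul_assoc])
  -- The half-net has at most `5^d` points. The exponent closes because `8 (16/25 - log 2 / 2)`
  -- exceeds `log 5`, bounded through `5³ ≤ 2⁷`.
  have hup : (N.card : ℝ) * Real.exp ((Real.log 2 / 2 - 64 / 25 / 4) * Fintype.card ι) ≤
      Real.exp (-l) := by
    have h5 : Real.log 5 ≤ 7 / 3 * Real.log 2 := by
      have : 3 * Real.log 5 ≤ 7 * Real.log 2 := by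
        have := Real.log_le_log (by norm_num : (0 : ℝ) < 5 ^ 3) (by norm_num : (5 : ℝ) ^ 3 ≤ 2 ^ 7)
        rwa [Real.log_pow, Real.log_pow] at this
      linarith
    have hc : (N.card : ℝ) ≤ Real.exp (d * Real.log 5) := by
      refine hNc.trans_eq ?_
      rw [Real.exp_nat_mul, Real.exp_log (by norm_num)]
      norm_num
    refine (mul_le_mul_of_nonneg_right hc (Real.exp_nonneg _)).trans ?_
    rw [← Real.exp_add, Real.exp_le_exp]
    have h1 := mul_le_mul_of_nonneg_left h5 hd
    have h2 := mul_le_mul_of_nonneg_left hM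
      (by linarith : (0 : ℝ) ≤ 64 / 25 / 4 - Real.log 2 / 2)
    nlinarith
  -- The `1/32`-net has at most `65^d` points, and `8 (3 log 2 / 2 - 7/16)` exceeds `log 65`. This
  -- is where the 8 in the bound on the number of rows is needed.
  have hlow : (N'.card : ℝ) * Real.exp ((7 / 16 - 3 * Real.log 2 / 2) * Fintype.card ι) ≤
      Real.exp (-l) := by
    have h65 : Real.log 65 ≤ 6 * Real.log 2 + 1 / 64 := by
      have : (65 : ℝ) = 2 ^ 6 * (65 / 64) := by norm_num
      rw [this, Real.log_mul (by norm_num) (by norm_num), Real.log_pow]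
      have := Real.log_le_sub_one_of_pos (by norm_num : (0 : ℝ) < 65 / 64)
      norm_num at this ⊢
      linarith
    have hc : (N'.card : ℝ) ≤ Real.exp (d * Real.log 65) := by
      refine hN'c.trans_eq ?_
      rw [Real.exp_nat_mul, Real.exp_log (by norm_num)]
      norm_num
    refine (mul_le_mul_of_nonneg_right hc (Real.exp_nonneg _)).trans ?_
    rw [← Real.exp_add, Real.exp_le_exp]
    have h1 := mul_le_mul_of_nonneg_left h65 hd
    have h2 := mul_le_mul_of_nonneg_left hM
      (by linarith : (0 : ℝ) ≤ 3 * Real.log 2 / 2 - 7 / 16)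
    nlinarith
  calc ν.real _ ≤ _ := measureReal_mono hsub (measure_ne_top _ _)
    _ ≤ _ := measureReal_union_le _ _
    _ ≤ (∑ y ∈ N, ν.real {z | 64 / 25 * Fintype.card ι * v ≤ ∑ i, (∑ j, y j * z i j) ^ 2}) +
        ∑ y ∈ N', ν.real {z | ∑ i, (∑ j, y j * z i j) ^ 2 ≤ 1 / 8 * Fintype.card ι * v} :=
      add_le_add (measureReal_biUnion_finset_le _ _) (measureReal_biUnion_finset_le _ _)
    _ ≤ (N.card : ℝ) * Real.exp ((Real.log 2 / 2 - 64 / 25 / 4) * Fintype.card ι) +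
        (N'.card : ℝ) * Real.exp ((7 / 16 - 3 * Real.log 2 / 2) * Fintype.card ι) := by
      rw [← nsmul_eq_mul, ← nsmul_eq_mul]
      exact add_le_add
        (Finset.sum_le_card_nsmul _ _ _ fun y hy =>
          measure_sum_sq_gaussian_ge hv (sum_sq_eq_one_of_norm (hN1 y hy)) _)
        (Finset.sum_le_card_nsmul _ _ _ fun y hy =>
          measure_sum_sq_gaussian_le hv (sum_sq_eq_one_of_norm (hN'1 y hy)))
    _ ≤ 2 * Real.exp (-l) := by linarith

variable {τ α : Type*} [Fintype τ] [Fintype α]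

/-- Gaussian noise is uniformly controlled on a subspace `W` of signals. -/
theorem measure_noise_bound {v : ℝ≥0} (hv : v ≠ 0) (W : Submodule ℝ (EuclideanSpace ℝ (ι × τ)))
    {s : ℝ} (hs : 0 ≤ s) :
    (Measure.pi fun _ : ι × τ × α => gaussianReal 0 v).real
      {z | ¬ ∀ a : EuclideanSpace ℝ α, ∀ w ∈ W,
        ∑ k : ι × τ × α, a k.2.2 * w (k.1, k.2.1) * z k ≤ 2 * (s * Real.sqrt v) * ‖a‖ * ‖w‖} ≤
      9 ^ (Fintype.card α + Module.finrank ℝ W) * Real.exp (-s ^ 2 / 2) := by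
  set μ := Measure.pi fun _ : ι × τ × α => gaussianReal 0 v
  obtain ⟨N, hN1, hNc, hN⟩ := exists_sphere_net (EuclideanSpace ℝ α) (ε := 1 / 4) (by norm_num)
  obtain ⟨N', hN'1, hN'c, hN'⟩ := exists_sphere_net W (ε := 1 / 4) (by norm_num)
  rw [finrank_euclideanSpace] at hNc
  -- The tensor product of two unit vectors is a unit vector, so each pair of net points gives a
  -- Gaussian linear form of variance `v`.
  have hunit : ∀ y ∈ N, ∀ y' ∈ N',
      ∑ k : ι × τ × α, (y k.2.2 * (y' : EuclideanSpace ℝ (ι × τ)) (k.1, k.2.1)) ^ 2 = 1 := by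
    intro y hy y' hy'
    have h1 := sum_sq_eq_one_of_norm (hN1 y hy)
    have h2 := sum_sq_eq_one_of_norm (x := (y' : EuclideanSpace ℝ (ι × τ))) (hN'1 y' hy')
    simp only [mul_pow, Fintype.sum_prod_type, ← Finset.sum_mul] at h2 ⊢
    simp [h1, h2]
  have hsub : {z : ι × τ × α → ℝ | ¬ ∀ a : EuclideanSpace ℝ α, ∀ w ∈ W,
        ∑ k : ι × τ × α, a k.2.2 * w (k.1, k.2.1) * z k ≤ 2 * (s * Real.sqrt v) * ‖a‖ * ‖w‖} ⊆
      ⋃ y ∈ N, ⋃ y' ∈ N', {z | s * Real.sqrt v ≤ ∑ k : ι × τ × α,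
        (y k.2.2 * (y' : EuclideanSpace ℝ (ι × τ)) (k.1, k.2.1)) * z k} := by
    intro z hz
    by_contra hcon
    simp only [Set.mem_iUnion, Set.mem_ofPred_eq, not_exists, not_le] at hcon
    refine hz fun a w hw => ?_
    let f : EuclideanSpace ℝ α →ₗ[ℝ] W →ₗ[ℝ] ℝ := LinearMap.mk₂ ℝ
      (fun a w => ∑ k : ι × τ × α, a k.2.2 * (w : EuclideanSpace ℝ (ι × τ)) (k.1, k.2.1) * z k)
      (fun a a' w => by simp [add_mul, Finset.sum_add_distrib])
      (fun c a w => by simp [Finset.mul_sum, mul_assoc])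
      (fun a w w' => by simp [mul_add, add_mul, Finset.sum_add_distrib])
      (fun c a w => by
        simp only [Submodule.coe_smul, PiLp.smul_apply, smul_eq_mul, Finset.mul_sum]
        exact Finset.sum_congr rfl fun k _ => by ring)
    exact bilin_le_of_net f.toContinuousBilinearMap (by positivity) hN'1 hN hN' (fun y hy y' hy' => (hcon y hy y' hy').le)
      a ⟨w, hw⟩
  calc μ.real _ ≤ _ := measureReal_mono hsub (measure_ne_top _ _)
    _ ≤ ∑ y ∈ N, ∑ y' ∈ N', μ.real {z | s * Real.sqrt v ≤ ∑ k : ι × τ × α,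
        (y k.2.2 * (y' : EuclideanSpace ℝ (ι × τ)) (k.1, k.2.1)) * z k} :=
      (measureReal_biUnion_finset_le _ _).trans
        (Finset.sum_le_sum fun y _ => measureReal_biUnion_finset_le _ _)
    _ ≤ ∑ y ∈ N, ∑ y' ∈ N', Real.exp (-s ^ 2 / 2) :=
      Finset.sum_le_sum fun y hy => Finset.sum_le_sum fun y' hy' =>
        measure_sum_mul_gaussian_ge (hunit y hy y' hy') hs hv
    _ = (N.card : ℝ) * N'.card * Real.exp (-s ^ 2 / 2) := by
      simp [mul_assoc]
    _ ≤ _ := by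
      rw [pow_add]
      norm_num at hNc hN'c
      gcongr

end Concentration

/-! ### Input-output relation and the least-squares error -/

section LeastSquares

variable {n du dy T : ℕ}

/-- The input sequence, extended by zero beyond the rollout length. -/
def extendInput (u : Fin T → Fin du → ℝ) (s : ℕ) : Fin du → ℝ :=
  if h : s < T then u ⟨s, h⟩ else 0

theorem state_eq_sum (A : Matrix (Fin n) (Fin n) ℝ) (B : Matrix (Fin n) (Fin du) ℝ)
    (u : Fin T → Fin du → ℝ) (t : ℕ) :
    state A B u t = ∑ s ∈ Finset.range t, (A ^ s * B) *ᵥ extendInput u (t - (s + 1)) := by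
  induction t with
  | zero => simp [state]
  | succ t ih =>
    rw [state, ih, Finset.sum_range_succ', Matrix.mulVec_sum]
    congr 1
    · refine Finset.sum_congr rfl fun s _ => ?_
      rw [Matrix.mulVec_mulVec, ← Matrix.mul_assoc, ← pow_succ', Nat.succ_sub_succ]
    · simp [extendInput]

/-- The block row `[0, C B, C A B, …]` of Markov parameters. -/
def markov (T : ℕ) (A : Matrix (Fin n) (Fin n) ℝ) (B : Matrix (Fin n) (Fin du) ℝ)
    (C : Matrix (Fin dy) (Fin n) ℝ) : Matrix (Fin dy) (Fin T × Fin du) ℝ :=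
  Matrix.of fun a rb => if (rb.1 : ℕ) = 0 then 0 else (C * A ^ ((rb.1 : ℕ) - 1) * B) a rb.2

/-- Unrolling the state recursion makes the output a convolution of the inputs with the Markov
parameters, which is what the Toeplitz product computes; block 0 vanishes since there is no
feedthrough. -/
theorem outputs_eq (A : Matrix (Fin n) (Fin n) ℝ) (B : Matrix (Fin n) (Fin du) ℝ)
    (C : Matrix (Fin dy) (Fin n) ℝ) (u : Fin T → Fin du → ℝ) (v : Fin T → Fin dy → ℝ) :
    outputs A B C u v = markov T A B C * inputToeplitz u + Matrix.of fun a t => v t a := by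
  ext a t
  simp only [outputs, Matrix.of_apply, Matrix.add_apply, Pi.add_apply]
  congr 1
  let g : ℕ → ℝ := fun r => if r = 0 then 0 else
    if r ≤ t then ((C * A ^ (r - 1) * B) *ᵥ extendInput u (t - r)) a else 0
  have h1 : (markov T A B C * inputToeplitz u) a t = ∑ r ∈ Finset.range T, g r := by
    rw [Matrix.mul_apply, Fintype.sum_prod_type, ← Fin.sum_univ_eq_sum_range]
    refine Finset.sum_congr rfl fun r _ => ?_
    simp only [markov, inputToeplitz, Matrix.of_apply, g]
    by_cases h0 : (r : ℕ) = 0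
    · simp [h0]
    · by_cases hr : r ≤ t
      · have hlt : (t : ℕ) - r < T := lt_of_le_of_lt (Nat.sub_le _ _) t.isLt
        simp [h0, hr, Matrix.mulVec, dotProduct, extendInput, hlt]
      · simp [h0, hr]
  have h2 : ∑ r ∈ Finset.range T, g r = ∑ r ∈ Finset.range ((t : ℕ) + 1), g r := by
    refine (Finset.sum_subset (Finset.range_mono t.isLt) fun r _ hr => ?_).symm
    have : ¬ r ≤ t := by simpa [Nat.lt_succ_iff] using hr
    simp [g, this]
  rw [h1, h2, Finset.sum_range_succ', state_eq_sum, Matrix.mulVec_sum, Finset.sum_apply]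
  simp only [g, if_true, add_zero, Nat.add_one_ne_zero, if_false, Nat.add_sub_cancel]
  refine Finset.sum_congr rfl fun s hs => ?_
  rw [if_pos (Nat.succ_le_of_lt (Finset.mem_range.1 hs)), Matrix.mulVec_mulVec, Matrix.mul_assoc]

variable {M : ℕ}

/-- Normal equations of the least-squares problem. -/
theorem sum_residual_mul_eq_zero (y : Fin M → Matrix (Fin dy) (Fin T) ℝ)
    (U : Fin M → Matrix (Fin T × Fin du) (Fin T) ℝ) {X : Matrix (Fin dy) (Fin T × Fin du) ℝ}
    (hX : ∀ X', squaredResidual y U X ≤ squaredResidual y U X')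
    (E : Matrix (Fin dy) (Fin T × Fin du) ℝ) :
    ∑ i, ∑ a, ∑ t, (y i - X * U i) a t * (E * U i) a t = 0 := by
  set b := ∑ i, ∑ a, ∑ t, (y i - X * U i) a t * (E * U i) a t with hb
  set c := ∑ i, ∑ a, ∑ t, ((E * U i) a t) ^ 2 with hc
  have hc0 : 0 ≤ c := by positivity
  have hexp : ∀ s : ℝ, squaredResidual y U (X + s • E) =
      squaredResidual y U X - 2 * s * b + s ^ 2 * c := by
    intro s
    simp only [squaredResidual, hb, hc, Finset.mul_sum, ← Finset.sum_sub_distrib,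
      ← Finset.sum_add_distrib]
    refine Finset.sum_congr rfl fun i _ => Finset.sum_congr rfl fun a _ =>
      Finset.sum_congr rfl fun t _ => ?_
    rw [Matrix.add_mul, Matrix.smul_mul]
    simp only [Matrix.sub_apply, Matrix.add_apply, Matrix.smul_apply, smul_eq_mul]
    ring
  -- The minimizing step would be `b / c`; `c + 1` avoids the case `c = 0` and still forces `b = 0`.
  have h := hX (X + (b / (c + 1)) • E)
  rw [hexp] at h
  have h1 : 2 * (b / (c + 1)) * b ≤ (b / (c + 1)) ^ 2 * c := by linarith
  have hc1 : 0 < c + 1 := by linarith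
  have h2 : 2 * b ^ 2 * (c + 1) ≤ b ^ 2 * c := by
    have := mul_le_mul_of_nonneg_right h1 (sq_nonneg (c + 1))
    have e1 : 2 * (b / (c + 1)) * b * (c + 1) ^ 2 = 2 * b ^ 2 * (c + 1) := by field_simp
    have e2 : (b / (c + 1)) ^ 2 * c * (c + 1) ^ 2 = b ^ 2 * c := by field_simp
    rwa [e1, e2] at this
  have h3 : b ^ 2 ≤ 0 := by nlinarith [sq_nonneg b, mul_nonneg (sq_nonneg b) hc0]
  exact pow_eq_zero_iff two_ne_zero |>.1 (le_antisymm h3 (sq_nonneg b))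

/-- The signal `x ↦ (xᵀ U⁽ⁱ⁾)_t` generated by the regressors of all rollouts. -/
def regressorMap (u : Fin M → Fin T → Fin du → ℝ) :
    (Fin T × Fin du → ℝ) →ₗ[ℝ] EuclideanSpace ℝ (Fin M × Fin T) where
  toFun x := WithLp.toLp 2 fun it => (x ᵥ* inputToeplitz (u it.1)) it.2
  map_add' x y := by
    ext it
    simp [Matrix.add_vecMul]
  map_smul' c x := by
    ext it
    simp [Matrix.smul_vecMul]

theorem regressorMap_apply (u : Fin M → Fin T → Fin du → ℝ) (x : Fin T × Fin du → ℝ)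
    (it : Fin M × Fin T) : regressorMap u x it = (x ᵥ* inputToeplitz (u it.1)) it.2 := rfl

theorem finrank_range_regressorMap_le (u : Fin M → Fin T → Fin du → ℝ) :
    Module.finrank ℝ (LinearMap.range (regressorMap u)) ≤ T * du := by
  refine (LinearMap.finrank_range_le _).trans ?_
  simp

/-- The last column of each regressor matrix already contains the whole input sequence. -/
theorem sum_sq_le_norm_regressorMap_sq (u : Fin M → Fin T → Fin du → ℝ) (hT : 0 < T)
    {c : ℝ} (hlow : ∀ x : Fin T × Fin du → ℝ, c * ∑ j, x j ^ 2 ≤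
      ∑ i, (∑ j : Fin T × Fin du, x j * u i j.1 j.2) ^ 2) (x : Fin T × Fin du → ℝ) :
    c * ∑ j, x j ^ 2 ≤ ‖regressorMap u x‖ ^ 2 := by
  -- The last column has `u_{T-1-r}` in block row `r`; reversing time restores the order of the
  -- inputs without changing `∑ x j ^ 2`.
  let e : Fin T × Fin du ≃ Fin T × Fin du := Equiv.prodCongr Fin.revPerm (Equiv.refl _)
  have h := hlow (x ∘ e)
  have e1 : ∑ j, (x ∘ e) j ^ 2 = ∑ j, x j ^ 2 := Equiv.sum_comp e fun j => x j ^ 2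
  rw [e1] at h
  refine h.trans ?_
  rw [EuclideanSpace.real_norm_sq_eq, Fintype.sum_prod_type]
  refine Finset.sum_le_sum fun i _ => ?_
  let t : Fin T := ⟨T - 1, by omega⟩
  refine le_trans (le_of_eq ?_)
    (Finset.single_le_sum (f := fun t => regressorMap u x (i, t) ^ 2)
      (fun _ _ => sq_nonneg _) (Finset.mem_univ t))
  congr 1
  rw [regressorMap_apply, Matrix.vecMul, dotProduct,
    ← Equiv.sum_comp e fun j => x j * inputToeplitz (u i) j t]
  refine Finset.sum_congr rfl fun j _ => ?_
  have hle : Fin.rev j.1 ≤ t := by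
    rw [Fin.le_def, Fin.val_rev]
    simp only [t]
    omega
  have hidx : ∀ h, (⟨(t : ℕ) - (T - ((j.1 : ℕ) + 1)), h⟩ : Fin T) = j.1 := by
    intro h
    ext
    have := j.1.isLt
    simp only [t]
    omega
  simp [e, inputToeplitz, hle, hidx]

/-- Error of the least-squares estimate, for well-conditioned inputs and controlled noise. -/
theorem norm_sub_markov_le (A : Matrix (Fin n) (Fin n) ℝ) (B : Matrix (Fin n) (Fin du) ℝ)
    (C : Matrix (Fin dy) (Fin n) ℝ) (u : Fin M → Fin T → Fin du → ℝ)
    (v : Fin M → Fin T → Fin dy → ℝ) (hT : 0 < T) {c η : ℝ} (hc : 0 < c) (hη : 0 ≤ η)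
    (hlow : ∀ x : Fin T × Fin du → ℝ, c * ∑ j, x j ^ 2 ≤
      ∑ i, (∑ j : Fin T × Fin du, x j * u i j.1 j.2) ^ 2)
    (hnoise : ∀ a : EuclideanSpace ℝ (Fin dy), ∀ w ∈ LinearMap.range (regressorMap u),
      ∑ k : Fin M × Fin T × Fin dy, a k.2.2 * w (k.1, k.2.1) * v k.1 k.2.1 k.2.2 ≤
        2 * η * ‖a‖ * ‖w‖)
    {X : Matrix (Fin dy) (Fin T × Fin du) ℝ} (hX : IsLeastSquares A B C u v X) :
    ‖X - markov T A B C‖ ≤ 2 * η / Real.sqrt c := by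
  set D := X - markov T A B C with hD
  -- The bound is proved for `Dᵀ`: with `x = Dᵀ a`, the signal `w` is both `aᵀ D U` and the signal
  -- tested by the rank-one direction `a xᵀ`.
  rw [← Matrix.l2_opNorm_conjTranspose, Matrix.conjTranspose_eq_transpose_of_trivial]
  refine opNorm_le_of_sum_sq _ (by positivity) fun a => ?_
  set x := Dᵀ *ᵥ a with hx
  set w := regressorMap u x with hw
  have hresid : ∀ i, outputs A B C (u i) (v i) - X * inputToeplitz (u i) =
      (Matrix.of fun b t => v i t b) - D * inputToeplitz (u i) := by
    intro i
    rw [outputs_eq, hD, Matrix.sub_mul]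
    abel
  have hDU : ∀ i t, ∑ b, a b * (D * inputToeplitz (u i)) b t = w (i, t) := by
    intro i t
    rw [hw, regressorMap_apply, hx, Matrix.mulVec_transpose, Matrix.vecMul_vecMul]
    rfl
  have hE : ∀ i b t, (Matrix.vecMulVec a x * inputToeplitz (u i)) b t = a b * w (i, t) := by
    intro i b t
    rw [Matrix.vecMulVec_mul]
    rfl
  have hnormal := sum_residual_mul_eq_zero _ _ hX (Matrix.vecMulVec a x)
  simp only [hresid] at hnormal
  simp only [hE, Matrix.sub_apply, Matrix.of_apply] at hnormal
  -- The normal equations in the direction `a xᵀ` express the energy of `w` as its pairing with the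
  -- noise.
  have hsplit : ‖w‖ ^ 2 =
      ∑ k : Fin M × Fin T × Fin dy, a k.2.2 * w (k.1, k.2.1) * v k.1 k.2.1 k.2.2 := by
    rw [EuclideanSpace.real_norm_sq_eq, Fintype.sum_prod_type, Fintype.sum_prod_type]
    rw [← sub_eq_zero, ← neg_eq_zero, ← hnormal, ← Finset.sum_sub_distrib, ← Finset.sum_neg_distrib]
    refine Finset.sum_congr rfl fun i _ => ?_
    rw [Fintype.sum_prod_type, Finset.sum_comm (s := (Finset.univ : Finset (Fin dy))),
      ← Finset.sum_sub_distrib, ← Finset.sum_neg_distrib]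
    refine Finset.sum_congr rfl fun t _ => ?_
    rw [neg_sub, sq]
    nth_rw 1 [← hDU i t]
    rw [Finset.sum_mul, ← Finset.sum_sub_distrib]
    exact Finset.sum_congr rfl fun b _ => by ring
  have hle : ‖w‖ ^ 2 ≤ 2 * η * ‖WithLp.toLp 2 a‖ * ‖w‖ :=
    hsplit.trans_le (hnoise (WithLp.toLp 2 a) w (LinearMap.mem_range_self _ _))
  have hle2 : ‖w‖ ≤ 2 * η * ‖WithLp.toLp 2 a‖ := by
    rcases (norm_nonneg w).eq_or_lt with h0 | h0
    · rw [← h0]; positivity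
    · rw [sq] at hle
      exact le_of_mul_le_mul_right hle h0
  have h1 := (sum_sq_le_norm_regressorMap_sq u hT hlow x).trans
    (pow_le_pow_left₀ (norm_nonneg _) hle2 2)
  rw [mul_pow, EuclideanSpace.real_norm_sq_eq] at h1
  rw [div_pow, Real.sq_sqrt hc.le, div_mul_eq_mul_div, le_div_iff₀ hc, mul_comm]
  exact h1

end LeastSquares

/-! ### Hankel matrices and truncated singular value decompositions -/

section Hankel

variable {n k du dy : ℕ}

/-- Each block row consists of distinct columns of `Φ`, so its norm is at most `‖Φ‖`; stacking `p`
of them costs `√p`. -/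
theorem norm_hankelOfMarkov_le (m p q : ℕ)
    (Φ : Matrix (Fin dy) (Fin (rolloutLength m p q) × Fin du) ℝ) :
    ‖hankelOfMarkov m p q Φ‖ ≤ Real.sqrt p * ‖Φ‖ := by
  refine opNorm_le_of_sum_sq _ (by positivity) fun x => ?_
  have hrow : ∀ i : Fin p, ∑ a, ((hankelOfMarkov m p q Φ *ᵥ x) (i, a)) ^ 2 ≤
      ‖Φ‖ ^ 2 * ∑ j, x j ^ 2 := by
    intro i
    let e : Fin q × Fin du → Fin (rolloutLength m p q) × Fin du := fun jb =>
      (⟨m + (i : ℕ) + (jb.1 : ℕ) + 1, by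
        have h1 := i.isLt
        have h2 := jb.1.isLt
        show m + (i : ℕ) + (jb.1 : ℕ) + 1 < m + p + q + 2
        omega⟩, jb.2)
    have he : Function.Injective e := by
      rintro ⟨j, b⟩ ⟨j', b'⟩ h
      simp only [e, Prod.mk.injEq, Fin.mk.injEq] at h
      ext
      · simp only; omega
      · simp [h.2]
    have h1 : ∀ a, (hankelOfMarkov m p q Φ *ᵥ x) (i, a) = (Φ *ᵥ Function.extend e x 0) a := by
      intro a
      refine Fintype.sum_of_injective e he _ _ (fun j hj => ?_) fun j => ?_
      · rw [Function.extend_apply' _ _ _ fun ⟨j', h⟩ => hj ⟨j', h⟩]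
        simp
      · rw [he.extend_apply]
        rfl
    have h2 : ∑ j, x j ^ 2 = ∑ j, (Function.extend e x 0 j) ^ 2 := by
      refine Fintype.sum_of_injective e he _ _ (fun j hj => ?_) fun j => ?_
      · rw [Function.extend_apply' _ _ _ fun ⟨j', h⟩ => hj ⟨j', h⟩]
        simp
      · rw [he.extend_apply]
    simp_rw [h1, h2]
    exact sum_sq_mulVec_le Φ _
  rw [Fintype.sum_prod_type, mul_pow, Real.sq_sqrt (Nat.cast_nonneg p), mul_assoc]
  exact (Finset.sum_le_sum fun i _ => hrow i).trans_eq (by simp)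

theorem hankelOfMarkov_markov (A : Matrix (Fin n) (Fin n) ℝ) (B : Matrix (Fin n) (Fin du) ℝ)
    (C : Matrix (Fin dy) (Fin n) ℝ) (m p q : ℕ) :
    hankelOfMarkov m p q (markov (rolloutLength m p q) A B C) = hankel A B C m p q := by
  ext ia jb
  simp [hankelOfMarkov, markov, hankel]

theorem norm_hankel_sub_hankelOfMarkov_le (A : Matrix (Fin n) (Fin n) ℝ)
    (B : Matrix (Fin n) (Fin du) ℝ) (C : Matrix (Fin dy) (Fin n) ℝ) (m p q : ℕ)
    (Φ : Matrix (Fin dy) (Fin (rolloutLength m p q) × Fin du) ℝ) :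
    ‖hankel A B C m p q - hankelOfMarkov m p q Φ‖ ≤ Real.sqrt p * ‖Φ - markov (rolloutLength m p q) A B C‖ := by
  rw [norm_sub_rev, ← hankelOfMarkov_markov]
  have e : hankelOfMarkov m p q Φ - hankelOfMarkov m p q (markov (rolloutLength m p q) A B C) =
      hankelOfMarkov m p q (Φ - markov (rolloutLength m p q) A B C) := by
    ext ia jb
    simp only [hankelOfMarkov, Matrix.of_apply, Matrix.sub_apply]
  rw [e]
  exact norm_hankelOfMarkov_le m p q (Φ - markov (rolloutLength m p q) A B C)

/-- A block matrix whose blocks have norm at most `β` has norm at most `√(pq) β`. -/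
theorem norm_block_le {p q : ℕ} (X : Matrix (Fin p × Fin dy) (Fin q × Fin du) ℝ)
    (G : Fin p → Fin q → Matrix (Fin dy) (Fin du) ℝ) (hX : ∀ i a j b, X (i, a) (j, b) = G i j a b)
    {β : ℝ} (hβ : 0 ≤ β) (hG : ∀ i j, ‖G i j‖ ≤ β) : ‖X‖ ≤ Real.sqrt p * Real.sqrt q * β := by
  refine opNorm_le_of_sum_sq _ (by positivity) fun x => ?_
  rw [mul_pow, mul_pow, Real.sq_sqrt (Nat.cast_nonneg _), Real.sq_sqrt (Nat.cast_nonneg _),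
    Fintype.sum_prod_type, Fintype.sum_prod_type]
  have hrow : ∀ i, ∑ a, ((X *ᵥ x) (i, a)) ^ 2 ≤ q * β ^ 2 * ∑ j, ∑ b, x (j, b) ^ 2 := by
    intro i
    have h1 : ∀ a, (X *ᵥ x) (i, a) = ∑ j, (G i j *ᵥ fun b => x (j, b)) a := by
      intro a
      simp only [Matrix.mulVec, dotProduct, Fintype.sum_prod_type, hX]
    calc ∑ a, ((X *ᵥ x) (i, a)) ^ 2
        ≤ ∑ a, (q : ℝ) * ∑ j, ((G i j *ᵥ fun b => x (j, b)) a) ^ 2 := by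
          refine Finset.sum_le_sum fun a _ => ?_
          rw [h1]
          refine sq_sum_le_card_mul_sum_sq.trans_eq (by simp)
      _ = (q : ℝ) * ∑ j, ∑ a, ((G i j *ᵥ fun b => x (j, b)) a) ^ 2 := by
          rw [← Finset.mul_sum, Finset.sum_comm]
      _ ≤ (q : ℝ) * ∑ j, β ^ 2 * ∑ b, x (j, b) ^ 2 := by
          gcongr with j
          refine (sum_sq_mulVec_le _ _).trans ?_
          gcongr
          exact hG i j
      _ = _ := by rw [← Finset.mul_sum]; ring
  refine (Finset.sum_le_sum fun i _ => hrow i).trans_eq ?_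
  simp
  ring

theorem sum_sq_mulVec_of_orthonormal {ι κ : Type*} [Fintype ι] [Fintype κ] [DecidableEq κ]
    {Q : Matrix ι κ ℝ} (hQ : Qᵀ * Q = 1) (x : κ → ℝ) : ∑ i, ((Q *ᵥ x) i) ^ 2 = ∑ j, x j ^ 2 := by
  rw [show ∑ i, ((Q *ᵥ x) i) ^ 2 = (Q *ᵥ x) ⬝ᵥ (Q *ᵥ x) by simp [dotProduct, sq],
    Matrix.dotProduct_mulVec, ← Matrix.mulVec_transpose, Matrix.mulVec_mulVec, hQ,
    Matrix.one_mulVec]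
  simp [dotProduct, sq]

theorem norm_le_one_of_orthonormal {ι κ : Type*} [Fintype ι] [Fintype κ] [DecidableEq κ]
    {Q : Matrix ι κ ℝ} (hQ : Qᵀ * Q = 1) : ‖Q‖ ≤ 1 :=
  opNorm_le_of_sum_sq _ zero_le_one fun x => by
    rw [sum_sq_mulVec_of_orthonormal hQ, one_pow, one_mul]

theorem norm_transpose {ι κ : Type*} [Fintype ι] [Fintype κ] [DecidableEq ι] [DecidableEq κ]
    (Q : Matrix ι κ ℝ) : ‖Qᵀ‖ = ‖Q‖ := by
  rw [← Matrix.conjTranspose_eq_transpose_of_trivial, Matrix.l2_opNorm_conjTranspose]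

/-- A truncated singular value decomposition is at least as close as any matrix factoring through
dimension `k`. -/
theorem IsTruncatedSVD.norm_sub_le {ι κ : Type*} [Fintype ι] [Fintype κ] [DecidableEq ι]
    [DecidableEq κ] {k : ℕ} {H K : Matrix ι κ ℝ} (h : IsTruncatedSVD k H K)
    (O : Matrix ι (Fin k) ℝ) (R : Matrix (Fin k) κ ℝ) : ‖K - H‖ ≤ ‖H - O * R‖ := by
  obtain ⟨r, U, V, s, hU, hV, hs, hs0, rfl, rfl⟩ := h
  have hdiff : U * Matrix.diagonal (fun i : Fin r => if (i : ℕ) < k then s i else 0) * Vᵀ -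
      U * Matrix.diagonal s * Vᵀ =
      U * Matrix.diagonal (fun i : Fin r => if (i : ℕ) < k then 0 else - s i) * Vᵀ := by
    rw [← Matrix.sub_mul, ← Matrix.mul_sub, Matrix.diagonal_sub]
    congr 3
    ext i
    split_ifs <;> simp
  rw [hdiff]
  have hnorm : ∀ d : Fin r → ℝ, ‖U * Matrix.diagonal d * Vᵀ‖ ≤ ‖d‖ := by
    intro d
    calc _ ≤ ‖U * Matrix.diagonal d‖ * ‖Vᵀ‖ := Matrix.l2_opNorm_mul _ _
      _ ≤ ‖U‖ * ‖Matrix.diagonal d‖ * ‖Vᵀ‖ := by gcongr; exact Matrix.l2_opNorm_mul _ _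
      _ ≤ 1 * ‖d‖ * 1 := by
        rw [norm_transpose, Matrix.l2_opNorm_diagonal]
        gcongr
        exacts [norm_le_one_of_orthonormal hU, norm_le_one_of_orthonormal hV]
      _ = ‖d‖ := by ring
  refine (hnorm _).trans ((pi_norm_le_iff_of_nonneg (norm_nonneg _)).2 fun i => ?_)
  split_ifs with hik
  · simp
  · rw [norm_neg, Real.norm_of_nonneg (hs0 i)]
    have hkr : k + 1 ≤ r := by have := i.isLt; omega
    let e : Fin (k + 1) → Fin r := Fin.castLE hkr
    have he : Function.Injective e := Fin.castLE_injective hkr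
    -- Dimension count: the first `k + 1` right singular directions contain a nonzero vector killed
    -- by `R`, which has only `k` rows. On it `H - O R` acts as `H`, which stretches by at least `s
    -- k ≥ s i`.
    obtain ⟨y, hy0, hy⟩ : ∃ y : Fin (k + 1) → ℝ, y ≠ 0 ∧
        (R * V * (Matrix.of fun a b => if e b = a then (1 : ℝ) else 0)) *ᵥ y = 0 := by
      have hlt : Module.finrank ℝ (Fin k → ℝ) < Module.finrank ℝ (Fin (k + 1) → ℝ) := by simp
      obtain ⟨y, hy, hy0⟩ := Submodule.exists_mem_ne_zero_of_ne_bot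
        (LinearMap.ker_ne_bot_of_finrank_lt (f := Matrix.mulVecLin
          (R * V * (Matrix.of fun a b => if e b = a then (1 : ℝ) else 0))) hlt)
      exact ⟨y, hy0, LinearMap.mem_ker.1 hy⟩
    set z : Fin r → ℝ := (Matrix.of fun a b => if e b = a then (1 : ℝ) else 0) *ᵥ y with hz
    have hze : ∀ b, z (e b) = y b := by
      intro b
      simp [hz, Matrix.mulVec, dotProduct, he.eq_iff]
    have hz0 : ∀ a, a ∉ Set.range e → z a = 0 := by
      intro a ha
      simp only [hz, Matrix.mulVec, dotProduct, Matrix.of_apply]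
      refine Finset.sum_eq_zero fun b _ => ?_
      rw [if_neg fun h => ha ⟨b, h⟩, zero_mul]
    have hzpos : 0 < ∑ a, z a ^ 2 := by
      obtain ⟨b, hb⟩ := Function.ne_iff.1 hy0
      refine Finset.sum_pos' (fun _ _ => sq_nonneg _) ⟨e b, Finset.mem_univ _, ?_⟩
      rw [hze]
      have : y b ≠ 0 := hb
      positivity
    have hRV : R *ᵥ (V *ᵥ z) = 0 := by
      rw [hz, Matrix.mulVec_mulVec, Matrix.mulVec_mulVec, hy]
    have happ : (U * Matrix.diagonal s * Vᵀ - O * R) *ᵥ (V *ᵥ z) =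
        U *ᵥ (Matrix.diagonal s *ᵥ z) := by
      rw [Matrix.sub_mulVec, ← Matrix.mulVec_mulVec _ O R, hRV, Matrix.mulVec_zero, sub_zero,
        ← Matrix.mulVec_mulVec, Matrix.mulVec_mulVec _ Vᵀ V, hV, Matrix.one_mulVec,
        ← Matrix.mulVec_mulVec]
    have h := sum_sq_mulVec_le (U * Matrix.diagonal s * Vᵀ - O * R) (V *ᵥ z)
    rw [happ, sum_sq_mulVec_of_orthonormal hU, sum_sq_mulVec_of_orthonormal hV] at h
    have hlow : s i ^ 2 * ∑ a, z a ^ 2 ≤ ∑ a, ((Matrix.diagonal s *ᵥ z) a) ^ 2 := by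
      rw [Finset.mul_sum]
      refine Finset.sum_le_sum fun a _ => ?_
      rw [Matrix.mulVec_diagonal, mul_pow]
      by_cases ha : a ∈ Set.range e
      · obtain ⟨b, rfl⟩ := ha
        have hle : e b ≤ i := by
          rw [Fin.le_def]
          have := b.isLt
          simp only [e, Fin.val_castLE]
          omega
        have := hs hle
        have := hs0 i
        gcongr
      · simp [hz0 a ha]
    exact le_of_sq_le_sq (le_of_mul_le_mul_right (hlow.trans h) hzpos) (norm_nonneg _)

end Hankel

/-! ### The stable remainder of the Hankel matrix -/

section Decomposition

variable {n k du dy : ℕ} {A : Matrix (Fin n) (Fin n) ℝ} {lam : Fin n → ℂ}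
  {Q₁ : Matrix (Fin n) (Fin k) ℝ} {Q₂ : Matrix (Fin n) (Fin (n - k)) ℝ}
  {R₁ : Matrix (Fin k) (Fin n) ℝ} {R₂ : Matrix (Fin (n - k)) (Fin n) ℝ}
  {N₁ : Matrix (Fin k) (Fin k) ℝ} {N₂ : Matrix (Fin (n - k)) (Fin (n - k)) ℝ}

theorem IsStabilityDecomposition.pow_eq
    (h : IsStabilityDecomposition A lam Q₁ Q₂ R₁ R₂ N₁ N₂) (l : ℕ) :
    A ^ l = Q₁ * N₁ ^ l * R₁ + Q₂ * N₂ ^ l * R₂ := by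
  have h1 : A ^ l = Matrix.fromCols Q₁ Q₂ * Matrix.fromBlocks N₁ 0 0 N₂ ^ l *
      Matrix.fromRows R₁ R₂ := by
    induction l with
    | zero => rw [pow_zero, pow_zero, Matrix.mul_one, h.right_inv]
    | succ l ih =>
      rw [pow_succ, ih]
      nth_rw 1 [h.decomp]
      rw [pow_succ]
      simp only [Matrix.mul_assoc]
      rw [← Matrix.mul_assoc (Matrix.fromRows R₁ R₂) (Matrix.fromCols Q₁ Q₂), h.left_inv,
        Matrix.one_mul]
  rw [h1, Matrix.fromBlocks_diagonal_pow, Matrix.fromCols_mul_fromBlocks, Matrix.fromCols_mul_fromRows]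
  simp

/-- Since `Q₁ R₁ + Q₂ R₂ = 1` and `Q₂ᵀ` is a contractive left inverse of `Q₂`, `R₂ B = Q₂ᵀ (B - Q₁
R₁ B)`. -/
theorem IsStabilityDecomposition.norm_R₂_mul_le
    (h : IsStabilityDecomposition A lam Q₁ Q₂ R₁ R₂ N₁ N₂) (B : Matrix (Fin n) (Fin du) ℝ) :
    ‖R₂ * B‖ ≤ ‖B‖ + ‖R₁ * B‖ := by
  have h1 : Q₂ * (R₂ * B) = B - Q₁ * (R₁ * B) := by
    have := h.pow_eq 0
    simp only [pow_zero, Matrix.mul_one] at this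
    rw [eq_sub_iff_add_eq, ← Matrix.mul_assoc, ← Matrix.mul_assoc, ← Matrix.add_mul, add_comm,
      ← this, Matrix.one_mul]
  have h2 : R₂ * B = Q₂ᵀ * (B - Q₁ * (R₁ * B)) := by
    rw [← h1, ← Matrix.mul_assoc, h.orthonormal₂, Matrix.one_mul]
  calc ‖R₂ * B‖ ≤ ‖Q₂ᵀ‖ * ‖B - Q₁ * (R₁ * B)‖ := h2 ▸ Matrix.l2_opNorm_mul _ _
    _ ≤ 1 * (‖B‖ + ‖Q₁‖ * ‖R₁ * B‖) := by
      gcongr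
      · rw [norm_transpose]; exact norm_le_one_of_orthonormal h.orthonormal₂
      · exact (norm_sub_le _ _).trans (add_le_add le_rfl (Matrix.l2_opNorm_mul _ _))
    _ ≤ 1 * (‖B‖ + 1 * ‖R₁ * B‖) := by
      gcongr
      exact norm_le_one_of_orthonormal h.orthonormal₁
    _ = _ := by ring

theorem hankelTilde_apply (C₁ : Matrix (Fin dy) (Fin k) ℝ) (N₁ : Matrix (Fin k) (Fin k) ℝ)
    (B₁ : Matrix (Fin k) (Fin du) ℝ) (m p q : ℕ) (ia : Fin p × Fin dy) (jb : Fin q × Fin du) :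
    hankelTilde C₁ N₁ B₁ m p q ia jb =
      (C₁ * N₁ ^ (m + (ia.1 : ℕ) + (jb.1 : ℕ)) * B₁) ia.2 jb.2 := by
  have h : C₁ * N₁ ^ (m + (ia.1 : ℕ) + (jb.1 : ℕ)) * B₁ =
      (C₁ * N₁ ^ (m / 2 + (ia.1 : ℕ))) * (N₁ ^ (m - m / 2 + (jb.1 : ℕ)) * B₁) := by
    have e : m + (ia.1 : ℕ) + (jb.1 : ℕ) = (m / 2 + ia.1) + (m - m / 2 + jb.1) := by omega
    rw [e, pow_add]
    simp only [Matrix.mul_assoc]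
  rw [h]
  rfl

theorem norm_hankel_sub_hankelTilde_le
    (h : IsStabilityDecomposition A lam Q₁ Q₂ R₁ R₂ N₁ N₂) (B : Matrix (Fin n) (Fin du) ℝ)
    (C : Matrix (Fin dy) (Fin n) ℝ) {m p q : ℕ} {L r : ℝ} (hr : 0 ≤ r) (hr1 : r ≤ 1) (hp : 1 ≤ p)
    (hB : ‖B‖ ≤ L) (hC : ‖C‖ ≤ L) (hRB : ‖R₁ * B‖ ≤ L)
    (hN₂ : ∀ t : ℕ, ‖N₂ ^ t‖ ≤ L * ((r + 1) / 2) ^ t) (hsmall : 4 ≤ p ∨ ‖R₂ * B‖ ≤ L) :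
    ‖hankel A B C m p q - hankelTilde (C * Q₁) N₁ (R₁ * B) m p q‖ ≤ epsTilde L r m p q := by
  have hL : 0 ≤ L := (norm_nonneg _).trans hB
  have hρ0 : 0 ≤ (r + 1) / 2 := by linarith
  have hρ1 : (r + 1) / 2 ≤ 1 := by linarith
  have hG : ∀ i : Fin p, ∀ j : Fin q,
      ‖C * (Q₂ * N₂ ^ (m + (i : ℕ) + (j : ℕ)) * R₂) * B‖ ≤
        L ^ 2 * ((r + 1) / 2) ^ m * ‖R₂ * B‖ := by
    intro i j
    have e : C * (Q₂ * N₂ ^ (m + (i : ℕ) + (j : ℕ)) * R₂) * B =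
        C * (Q₂ * (N₂ ^ (m + (i : ℕ) + (j : ℕ)) * (R₂ * B))) := by
      simp only [Matrix.mul_assoc]
    have hpow : ((r + 1) / 2) ^ (m + (i : ℕ) + (j : ℕ)) ≤ ((r + 1) / 2) ^ m :=
      pow_le_pow_of_le_one hρ0 hρ1 (by omega)
    rw [e]
    calc _ ≤ ‖C‖ * (‖Q₂‖ * (‖N₂ ^ (m + (i : ℕ) + (j : ℕ))‖ * ‖R₂ * B‖)) := by
          refine (Matrix.l2_opNorm_mul _ _).trans ?_
          gcongr
          refine (Matrix.l2_opNorm_mul _ _).trans ?_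
          gcongr
          exact Matrix.l2_opNorm_mul _ _
      _ ≤ L * (1 * (L * ((r + 1) / 2) ^ m * ‖R₂ * B‖)) := by
          gcongr
          · exact norm_le_one_of_orthonormal h.orthonormal₂
          · exact (hN₂ _).trans (by gcongr)
      _ = _ := by ring
  have hblock := norm_block_le (hankel A B C m p q - hankelTilde (C * Q₁) N₁ (R₁ * B) m p q)
    (fun i j => C * (Q₂ * N₂ ^ (m + (i : ℕ) + (j : ℕ)) * R₂) * B) (fun i a j b => by
      rw [Matrix.sub_apply, hankelTilde_apply]
      simp only [hankel, Matrix.of_apply]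
      rw [← Matrix.sub_apply, h.pow_eq]
      simp only [Matrix.mul_add, Matrix.add_mul, Matrix.mul_assoc, add_sub_cancel_left])
    (by positivity) hG
  refine hblock.trans ?_
  have hp' : (1 : ℝ) ≤ p := by exact_mod_cast hp
  -- For `p ≥ 4`, `‖R₂ B‖ ≤ 2L ≤ √p L`; otherwise `‖R₂ B‖ ≤ L` and `√p ≤ p`.
  have hkey : Real.sqrt p * ‖R₂ * B‖ ≤ p * L := by
    have hsq : Real.sqrt p * Real.sqrt p = p := Real.mul_self_sqrt (by positivity)
    rcases hsmall with h4 | hR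
    · have h2 : 2 ≤ Real.sqrt p := by
        rw [Real.le_sqrt' two_pos]
        norm_num
        exact_mod_cast h4
      have h3 : ‖R₂ * B‖ ≤ 2 * L := by linarith [h.norm_R₂_mul_le B]
      calc Real.sqrt p * ‖R₂ * B‖ ≤ Real.sqrt p * (Real.sqrt p * L) := by
            gcongr
            exact h3.trans (by gcongr)
        _ = p * L := by rw [← mul_assoc, hsq]
    · have : Real.sqrt p ≤ p := Real.sqrt_le_iff.2 ⟨by positivity, by nlinarith⟩
      gcongr
  calc Real.sqrt p * Real.sqrt q * (L ^ 2 * ((r + 1) / 2) ^ m * ‖R₂ * B‖)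
      = Real.sqrt q * L ^ 2 * ((r + 1) / 2) ^ m * (Real.sqrt p * ‖R₂ * B‖) := by ring
    _ ≤ Real.sqrt q * L ^ 2 * ((r + 1) / 2) ^ m * (p * L) := by gcongr
    _ = epsTilde L r m p q := by rw [epsTilde]; ring

end Decomposition

/-! ### The good event and its probability -/

section Data

variable {M T du dy : ℕ}

/-- Joint law of the inputs (grouped by rollout) and of the noises. -/
theorem IsGaussianData.hasLaw {Ω : Type*} [MeasurableSpace Ω] {P : Measure Ω} {σu σv : ℝ}
    {u : Fin M → Fin T → Fin du → Ω → ℝ} {v : Fin M → Fin T → Fin dy → Ω → ℝ}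
    (h : IsGaussianData P σu σv u v) :
    HasLaw (fun ω => ((fun i (j : Fin T × Fin du) => u i j.1 j.2 ω : Fin M → Fin T × Fin du → ℝ),
        (fun k => v k.1 k.2.1 k.2.2 ω : Fin M × Fin T × Fin dy → ℝ)))
      ((Measure.pi fun _ : Fin M => Measure.pi fun _ : Fin T × Fin du =>
          gaussianReal 0 (σu ^ 2).toNNReal).prod
        (Measure.pi fun _ : Fin M × Fin T × Fin dy => gaussianReal 0 (σv ^ 2).toNNReal)) P := by
  let μ : (Fin M × Fin T × Fin du) ⊕ (Fin M × Fin T × Fin dy) → Measure ℝ :=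
    Sum.elim (fun _ => gaussianReal 0 (σu ^ 2).toNNReal) fun _ => gaussianReal 0 (σv ^ 2).toNNReal
  have hμ : ∀ s, IsProbabilityMeasure (μ s) := by
    rintro (x | x) <;> simp only [μ, Sum.elim_inl, Sum.elim_inr] <;> infer_instance
  have h0 := h.indep.hasLaw_pi (μ := μ) (by
    rintro (x | x)
    exacts [h.law_u _ _ _, h.law_v _ _ _])
  have h1 := measurePreserving_sumPiEquivProdPi μ
  have h2 : MeasurePreserving (MeasurableEquiv.curry (Fin M) (Fin T × Fin du) ℝ)
      (Measure.pi fun i => μ (.inl i))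
      (Measure.pi fun _ : Fin M => Measure.pi fun _ : Fin T × Fin du =>
          gaussianReal 0 (σu ^ 2).toNNReal) := by
    refine ⟨MeasurableEquiv.measurable _, ?_⟩
    have := Measure.infinitePi_map_curry (ι := Fin M) (κ := Fin T × Fin du)
      fun _ _ => gaussianReal 0 (σu ^ 2).toNNReal
    simp only [Measure.infinitePi_eq_pi] at this
    exact this
  have h3 := h2.prod (MeasurePreserving.id (Measure.pi fun i => μ (.inr i)))
  exact (h3.comp h1).comp_hasLaw h0

theorem continuous_regressorMap (x : Fin T × Fin du → ℝ) :
    Continuous fun z : Fin M → Fin T × Fin du → ℝ => regressorMap (fun i t b => z i (t, b)) x := by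
  refine (PiLp.continuous_toLp 2 _).comp (continuous_pi fun it => ?_)
  simp only [Matrix.vecMul, dotProduct, inputToeplitz, Matrix.of_apply]
  refine continuous_finsetSum _ fun j _ => ?_
  split_ifs <;> fun_prop

/-- Data for which the inputs are well conditioned (level `c`) and the noise is controlled on the
range of the regressors (level `η`). -/
def goodData (M T du dy : ℕ) (c η : ℝ) :
    Set ((Fin M → Fin T × Fin du → ℝ) × (Fin M × Fin T × Fin dy → ℝ)) :=
  {z | ∀ x : Fin T × Fin du → ℝ, c * ∑ j, x j ^ 2 ≤ ∑ i, (∑ j, x j * z.1 i j) ^ 2} ∩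
  {z | ∀ a : EuclideanSpace ℝ (Fin dy), ∀ x : Fin T × Fin du → ℝ,
    ∑ k : Fin M × Fin T × Fin dy,
        a k.2.2 * regressorMap (fun i t b => z.1 i (t, b)) x (k.1, k.2.1) * z.2 k ≤
      2 * η * ‖a‖ * ‖regressorMap (fun i t b => z.1 i (t, b)) x‖}

theorem mem_goodData {c η : ℝ} {z : Fin M → Fin T × Fin du → ℝ}
    {y : Fin M × Fin T × Fin dy → ℝ} :
    (z, y) ∈ goodData M T du dy c η ↔
      (∀ x : Fin T × Fin du → ℝ, c * ∑ j, x j ^ 2 ≤ ∑ i, (∑ j, x j * z i j) ^ 2) ∧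
      ∀ a : EuclideanSpace ℝ (Fin dy), ∀ x : Fin T × Fin du → ℝ,
        ∑ k : Fin M × Fin T × Fin dy,
            a k.2.2 * regressorMap (fun i t b => z i (t, b)) x (k.1, k.2.1) * y k ≤
          2 * η * ‖a‖ * ‖regressorMap (fun i t b => z i (t, b)) x‖ :=
  Iff.rfl

/-- Although the conditions range over uncountably many vectors, each is closed in the data, hence
so is their intersection. -/
theorem measurableSet_goodData (c η : ℝ) : MeasurableSet (goodData M T du dy c η) := by
  refine (IsClosed.inter ?_ ?_).measurableSet
  · simp only [Set.ofPred_forall]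
    exact isClosed_iInter fun x => isClosed_le (by fun_prop) (by fun_prop)
  · simp only [Set.ofPred_forall]
    refine isClosed_iInter fun a => isClosed_iInter fun x => ?_
    have h : Continuous fun z : (Fin M → Fin T × Fin du → ℝ) × (Fin M × Fin T × Fin dy → ℝ) =>
        regressorMap (fun i t b => z.1 i (t, b)) x := (continuous_regressorMap x).comp continuous_fst
    refine isClosed_le (continuous_finsetSum _ fun k _ => ?_) (by fun_prop)
    have hk := (PiLp.continuous_apply 2 (fun _ : Fin M × Fin T => ℝ) (k.1, k.2.1)).comp h
    exact (continuous_const.mul hk).mul (by fun_prop)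

/-- Fubini over the inputs: ill-conditioned inputs are counted with full mass, and for the others
the noise bound applies to the then fixed range of the regressors. -/
theorem measureReal_compl_goodData_le {vu vv : NNReal} (hvu : vu ≠ 0) (hvv : vv ≠ 0) {l s : ℝ}
    (hl : 0 ≤ l) (hs : 0 ≤ s) (hM : 8 * (T * du : ℝ) + 16 * l ≤ M) :
    ((Measure.pi fun _ : Fin M => Measure.pi fun _ : Fin T × Fin du => gaussianReal 0 vu).prod
      (Measure.pi fun _ : Fin M × Fin T × Fin dy => gaussianReal 0 vv)).real
        (goodData M T du dy (M * vu / 16) (s * Real.sqrt vv))ᶜ ≤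
      2 * Real.exp (-l) + 9 ^ (dy + T * du) * Real.exp (-s ^ 2 / 2) := by
  set μ := Measure.pi fun _ : Fin M => Measure.pi fun _ : Fin T × Fin du => gaussianReal 0 vu
  set ν := Measure.pi fun _ : Fin M × Fin T × Fin dy => gaussianReal 0 vv
  set G := goodData M T du dy (M * vu / 16) (s * Real.sqrt vv)
  set S := {z : Fin M → Fin T × Fin du → ℝ | ¬ ∀ x : Fin T × Fin du → ℝ,
    M * vu / 16 * ∑ j, x j ^ 2 ≤ ∑ i, (∑ j, x j * z i j) ^ 2} with hS
  have hμS : μ.real S ≤ 2 * Real.exp (-l) := by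
    have := measure_rows_lower_bound (ι := Fin M) (κ := Fin T × Fin du) hvu hl (by
      simpa using hM)
    simpa only [Fintype.card_fin] using this
  set b := (9 : ℝ) ^ (dy + T * du) * Real.exp (-s ^ 2 / 2) with hb
  have hb0 : 0 ≤ b := by positivity
  have hsec : ∀ z, ν (Prod.mk z ⁻¹' Gᶜ) ≤ S.indicator (fun _ => 1) z + ENNReal.ofReal b := by
    intro z
    by_cases hz : z ∈ S
    · rw [Set.indicator_of_mem hz]
      exact prob_le_one.trans le_self_add
    · rw [Set.indicator_of_notMem hz, zero_add,
        ← ENNReal.ofReal_toReal (measure_ne_top ν _)]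
      refine ENNReal.ofReal_le_ofReal ?_
      have hW := measure_noise_bound (α := Fin dy) hvv
        (LinearMap.range (regressorMap fun i t b => z i (t, b))) hs
      have hz' := not_not.1 hz
      refine (measureReal_mono ?_ (measure_ne_top ν _)).trans (hW.trans ?_)
      · intro y hy hcon
        exact hy ⟨hz', fun a x => hcon a _ (LinearMap.mem_range_self _ x)⟩
      · rw [hb, Fintype.card_fin]
        gcongr
        · norm_num
        · exact finrank_range_regressorMap_le _
  have hprod : (μ.prod ν) Gᶜ ≤ μ S + ENNReal.ofReal b := by
    rw [Measure.prod_apply (measurableSet_goodData _ _).compl]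
    have hSm : MeasurableSet S := by
      rw [hS]
      rw [← Set.compl_ofPred]
      refine MeasurableSet.compl (IsClosed.measurableSet ?_)
      simp only [Set.ofPred_forall]
      exact isClosed_iInter fun x => isClosed_le (by fun_prop) (by fun_prop)
    refine (lintegral_mono hsec).trans ?_
    rw [lintegral_add_right _ measurable_const, lintegral_indicator hSm]
    simp
  have h2 := ENNReal.toReal_mono (by finiteness) hprod
  rw [ENNReal.toReal_add (measure_ne_top _ _) ENNReal.ofReal_ne_top, ENNReal.toReal_ofReal hb0] at h2
  exact h2.trans (by gcongr; exact hμS)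

/-- High-probability error bound for the least-squares estimate of the Markov parameters. -/
theorem IsGaussianData.exists_leastSquares_error_le {Ω : Type*} [MeasurableSpace Ω]
    {P : Measure Ω} [IsProbabilityMeasure P] {n : ℕ} {σu σv : ℝ}
    {u : Fin M → Fin T → Fin du → Ω → ℝ} {v : Fin M → Fin T → Fin dy → Ω → ℝ}
    (hdata : IsGaussianData P σu σv u v) (hσu : 0 < σu) (hσv : 0 < σv) (hT4 : 4 ≤ T)
    (A : Matrix (Fin n) (Fin n) ℝ) (B : Matrix (Fin n) (Fin du) ℝ) (C : Matrix (Fin dy) (Fin n) ℝ)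
    {δ : ℝ} (hδ₀ : 0 < δ) (hδ₁ : δ < 1)
    (hM : 8 * (du : ℝ) * T + 4 * ((du : ℝ) + dy + 4) * Real.log (3 * T / δ) < M) :
    ∃ E : Set Ω, MeasurableSet E ∧ 1 - δ ≤ P.real E ∧
      ∀ ω ∈ E, ∀ X : Matrix (Fin dy) (Fin T × Fin du) ℝ,
        IsLeastSquares A B C (fun i t a => u i t a ω) (fun i t a => v i t a ω) X →
        ‖X - markov T A B C‖ ≤
          8 * σv * Real.sqrt (2 * ((dy + (T : ℝ) * du) * Real.log 9 + Real.log (2 / δ))) /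
            (σu * Real.sqrt M) := by
  have hT4' : (4 : ℝ) ≤ T := by exact_mod_cast hT4
  set vu := (σu ^ 2).toNNReal with hvu
  set vv := (σv ^ 2).toNNReal with hvv
  have hvu' : (vu : ℝ) = σu ^ 2 := Real.coe_toNNReal _ (sq_nonneg _)
  have hvv' : (vv : ℝ) = σv ^ 2 := Real.coe_toNNReal _ (sq_nonneg _)
  have hvu0 : vu ≠ 0 := by
    rw [← NNReal.coe_ne_zero, hvu']
    positivity
  have hvv0 : vv ≠ 0 := by
    rw [← NNReal.coe_ne_zero, hvv']
    positivity
  set l := Real.log (3 * (T : ℝ) / δ) with hl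
  have hl0 : 0 ≤ l := by
    refine Real.log_nonneg ?_
    rw [le_div_iff₀ hδ₀]
    linarith
  have hdu0 : (0 : ℝ) ≤ du := Nat.cast_nonneg _
  have hdy0 : (0 : ℝ) ≤ dy := Nat.cast_nonneg _
  -- `4 (du + dy + 4) ≥ 16`.
  have hM' : 8 * (T * du : ℝ) + 16 * l ≤ M := by nlinarith
  have hMpos : (0 : ℝ) < M := by
    refine lt_of_le_of_lt ?_ hM
    positivity
  set N : ℝ := (dy + (T : ℝ) * du) * Real.log 9 + Real.log (2 / δ) with hN
  have h9 : 0 < Real.log 9 := Real.log_pos (by norm_num)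
  have hlog2 : 0 < Real.log (2 / δ) := by
    refine Real.log_pos ?_
    rw [lt_div_iff₀ hδ₀]
    linarith
  have hN0 : 0 ≤ N := by positivity
  set s := Real.sqrt (2 * N) with hs
  have hs2 : s ^ 2 = 2 * N := Real.sq_sqrt (by positivity)
  set G := goodData M T du dy (M * vu / 16) (s * Real.sqrt vv) with hG
  have hbad := measureReal_compl_goodData_le (T := T) (du := du) (dy := dy) hvu0 hvv0 hl0
    (Real.sqrt_nonneg (2 * N)) hM'
  -- The inputs fail with probability at most `2δ/(3T) ≤ δ/6`, since `T ≥ 4`; `s` is chosen so that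
  -- the noise term is exactly `δ/2`.
  have hbadδ : 2 * Real.exp (-l) + 9 ^ (dy + T * du) * Real.exp (-s ^ 2 / 2) ≤ δ := by
    have h1 : Real.exp (-l) ≤ δ / 12 := by
      rw [hl, Real.exp_neg, Real.exp_log (by positivity), inv_div]
      gcongr
      linarith
    have h2 : (9 : ℝ) ^ (dy + T * du) * Real.exp (-s ^ 2 / 2) = δ / 2 := by
      have e9 : (9 : ℝ) ^ (dy + T * du) = Real.exp ((dy + (T : ℝ) * du) * Real.log 9) := by
        rw [← Real.exp_log (by positivity : (0 : ℝ) < 9 ^ (dy + T * du)), Real.log_pow]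
        push_cast
        rfl
      have e2 : δ / 2 = Real.exp (-Real.log (2 / δ)) := by
        rw [Real.exp_neg, Real.exp_log (by positivity), inv_div]
      rw [e9, e2, ← Real.exp_add, hs2, hN]
      congr 1
      ring
    linarith
  have hlaw := hdata.hasLaw
  have hGm : MeasurableSet G := measurableSet_goodData _ _
  -- The data are only almost everywhere measurable, so the preimage of the good set is replaced by
  -- a measurable subset of equal probability.
  obtain ⟨E, hEsub, hEm, hEae⟩ :=
    (hlaw.aemeasurable.nullMeasurableSet_preimage hGm).exists_measurable_subset_ae_eq
  refine ⟨E, hEm, ?_, fun ω hω X hΦ => ?_⟩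
  · rw [measureReal_congr hEae, ← map_measureReal_apply_of_aemeasurable hlaw.aemeasurable hGm,
      hlaw.map_eq]
    rw [probReal_compl_eq_one_sub hGm] at hbad
    linarith
  obtain ⟨hlow, hnoise⟩ := mem_goodData.1 (hEsub hω)
  have herr := norm_sub_markov_le A B C (fun i t a => u i t a ω) (fun i t a => v i t a ω)
    (by omega) (c := M * vu / 16) (η := s * Real.sqrt vv) (by positivity) (by positivity) hlow
    (by
      rintro a w ⟨x, rfl⟩
      exact hnoise a x) hΦ
  refine herr.trans_eq ?_
  rw [hvu', hvv', Real.sqrt_sq hσv.le, Real.sqrt_div (by positivity),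
    Real.sqrt_mul (by positivity), Real.sqrt_sq hσu.le,
    show Real.sqrt 16 = 4 by
      rw [show (16 : ℝ) = 4 ^ 2 by norm_num]
      exact Real.sqrt_sq (by norm_num)]
  field_simp
  ring

end Data

/-! ### Comparison of the error levels -/

/-- The noise level of the net argument is dominated by the least-squares error level. -/
theorem noise_level_lt {du dy m p q : ℕ} (hp : 1 ≤ p) (hq : 1 ≤ q) (hS : 1 ≤ du + dy) {δ : ℝ}
    (hδ₀ : 0 < δ) (hδ₁ : δ < 1) :
    (p : ℝ) * (2 * ((dy + (rolloutLength m p q : ℝ) * du) * Real.log 9 + Real.log (2 / δ))) <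
      (rolloutLength m p q : ℝ) * ((rolloutLength m p q : ℝ) + 1) * ((du : ℝ) + dy) *
        (min p q : ℕ) * Real.log (27 * (rolloutLength m p q : ℝ) / δ) := by
  set T : ℝ := (rolloutLength m p q : ℝ) with hT
  have hTp : (p : ℝ) + 3 ≤ T := by
    rw [hT]
    have : p + 3 ≤ rolloutLength m p q := by
      show p + 3 ≤ m + p + q + 2
      omega
    exact_mod_cast this
  have hp' : (1 : ℝ) ≤ p := by exact_mod_cast hp
  have hmin : (1 : ℝ) ≤ (min p q : ℕ) := by exact_mod_cast le_min hp hq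
  have hS' : (1 : ℝ) ≤ du + dy := by exact_mod_cast hS
  have hdu : (0 : ℝ) ≤ du := Nat.cast_nonneg _
  have hdy : (0 : ℝ) ≤ dy := Nat.cast_nonneg _
  set l := Real.log (27 * T / δ) with hl
  -- `27 T / δ ≥ 81` because `T ≥ 4`.
  have hl9 : 2 * Real.log 9 ≤ l := by
    have e : 2 * Real.log 9 = Real.log 81 := by
      rw [show (81 : ℝ) = 9 ^ 2 by norm_num, Real.log_pow]; norm_num
    rw [e]
    refine Real.log_le_log (by norm_num) ?_
    rw [le_div_iff₀ hδ₀]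
    nlinarith
  have hl2 : Real.log (2 / δ) ≤ l := by
    refine Real.log_le_log (by positivity) ?_
    gcongr
    linarith
  have h9 : 0 < Real.log 9 := Real.log_pos (by norm_num)
  have hl0 : 0 < l := by linarith
  have hdim : dy + T * du ≤ T * (du + dy) := by nlinarith
  calc (p : ℝ) * (2 * ((dy + T * du) * Real.log 9 + Real.log (2 / δ)))
      = p * ((dy + T * du) * (2 * Real.log 9) + 2 * Real.log (2 / δ)) := by ring
    _ ≤ p * (T * (du + dy) * l + 2 * l) := by gcongr
    -- The factor `p` from stacking block rows is absorbed by one factor of `T`; of `min p q` only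
    -- the bound `≥ 1` is used.
    _ ≤ (T - 3) * (T * (du + dy) * l + 2 * l) := by
        have : (p : ℝ) ≤ T - 3 := by linarith
        have h0 : 0 ≤ T * (du + dy) * l + 2 * l := by
          have : 0 ≤ T := by linarith
          positivity
        exact mul_le_mul_of_nonneg_right this h0
    _ = ((T - 3) * (T * (du + dy) + 2)) * l := by ring
    _ < (T * (T + 1) * (du + dy)) * l := by
        refine mul_lt_mul_of_pos_right ?_ hl0
        nlinarith
    _ = T * (T + 1) * (du + dy) * 1 * l := by ring
    _ ≤ T * (T + 1) * (du + dy) * (min p q : ℕ) * l := by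
        have : 0 ≤ T := by linarith
        gcongr

end LTI

end


/-! ### Assembly of the bounds -/

theorem lemma1 {Ω : Type*} [MeasurableSpace Ω] (P : Measure Ω) [IsProbabilityMeasure P]
    {n k du dy M m p q : ℕ} (hk : 1 ≤ k) (hkn : k < n) (hp : 1 ≤ p) (hq : 1 ≤ q)
    -- the system, its ordered spectrum and its unstable/stable decomposition
    (A : Matrix (Fin n) (Fin n) ℝ) (B : Matrix (Fin n) (Fin du) ℝ) (C : Matrix (Fin dy) (Fin n) ℝ)
    (lam : Fin n → ℂ) (hlam : LTI.IsOrderedSpectrum A k lam)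
    (Q₁ : Matrix (Fin n) (Fin k) ℝ) (Q₂ : Matrix (Fin n) (Fin (n - k)) ℝ)
    (R₁ : Matrix (Fin k) (Fin n) ℝ) (R₂ : Matrix (Fin (n - k)) (Fin n) ℝ)
    (N₁ : Matrix (Fin k) (Fin k) ℝ) (N₂ : Matrix (Fin (n - k)) (Fin (n - k)) ℝ)
    (hdec : LTI.IsStabilityDecomposition A lam Q₁ Q₂ R₁ R₂ N₁ N₂)
    -- the umbrella upper bound
    (L : ℝ) (hB : ‖B‖ ≤ L) (hC : ‖C‖ ≤ L) (hRB : ‖R₁ * B‖ ≤ L)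
    (hN₂ : ∀ t : ℕ, ‖N₂ ^ t‖ ≤ L * ((‖lam ⟨k, hkn⟩‖ + 1) / 2) ^ t)
    (hsmall : 4 ≤ p ∨ ‖R₂ * B‖ ≤ L)
    -- the data
    (σu σv : ℝ) (hσu : 0 < σu) (hσv : 0 < σv)
    (u : Fin M → Fin (LTI.rolloutLength m p q) → Fin du → Ω → ℝ)
    (v : Fin M → Fin (LTI.rolloutLength m p q) → Fin dy → Ω → ℝ)
    (hdata : LTI.IsGaussianData P σu σv u v)
    (δ : ℝ) (hδ₀ : 0 < δ) (hδ₁ : δ < 1)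
    (hM : 8 * (du : ℝ) * (LTI.rolloutLength m p q : ℝ) +
      4 * ((du : ℝ) + dy + 4) * Real.log (3 * (LTI.rolloutLength m p q : ℝ) / δ) < M) :
    ‖LTI.hankel A B C m p q - LTI.hankelTilde (C * Q₁) N₁ (R₁ * B) m p q‖ ≤
        LTI.epsTilde L ‖lam ⟨k, hkn⟩‖ m p q ∧
    ∃ E : Set Ω, MeasurableSet E ∧ 1 - δ ≤ P.real E ∧
      ∀ ω ∈ E, ∀ Φhat : Matrix (Fin dy) (Fin (LTI.rolloutLength m p q) × Fin du) ℝ,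
        LTI.IsLeastSquares A B C (fun i t a => u i t a ω) (fun i t a => v i t a ω) Φhat →
        ‖LTI.hankel A B C m p q - LTI.hankelOfMarkov m p q Φhat‖ ≤
            LTI.epsHat σu σv du dy m p q M δ ∧
        ∀ Hhat : Matrix (Fin p × Fin dy) (Fin q × Fin du) ℝ,
          LTI.IsTruncatedSVD k (LTI.hankelOfMarkov m p q Φhat) Hhat →
          ‖Hhat - LTI.hankelTilde (C * Q₁) N₁ (R₁ * B) m p q‖ <
            2 * LTI.epsHat σu σv du dy m p q M δ + 2 * LTI.epsTilde L ‖lam ⟨k, hkn⟩‖ m p q := by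
  have hr0 : 0 ≤ ‖lam ⟨k, hkn⟩‖ := norm_nonneg _
  have hr1 : ‖lam ⟨k, hkn⟩‖ ≤ 1 := (hlam.stable ⟨k, hkn⟩ le_rfl).le
  have hdet := LTI.norm_hankel_sub_hankelTilde_le (q := q) (m := m) hdec B C hr0 hr1 hp hB hC hRB
    hN₂ hsmall
  refine ⟨hdet, ?_⟩
  have hT4 : 4 ≤ LTI.rolloutLength m p q := by
    show 4 ≤ m + p + q + 2
    omega
  obtain ⟨E, hEm, hE, hLS⟩ := hdata.exists_leastSquares_error_le hσu hσv hT4 A B C hδ₀ hδ₁ hM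
  refine ⟨E, hEm, hE, fun ω hω Φhat hΦ => ?_⟩
  have hMpos : (0 : ℝ) < M := by
    have hl : 0 ≤ Real.log (3 * (LTI.rolloutLength m p q : ℝ) / δ) := by
      refine Real.log_nonneg ?_
      rw [le_div_iff₀ hδ₀]
      have : (4 : ℝ) ≤ LTI.rolloutLength m p q := by exact_mod_cast hT4
      linarith
    refine lt_of_le_of_lt ?_ hM
    positivity
  have hlog2 : 0 < Real.log (2 / δ) := by
    refine Real.log_pos ?_
    rw [lt_div_iff₀ hδ₀]
    linarith
  have hle : ‖LTI.hankel A B C m p q - LTI.hankelOfMarkov m p q Φhat‖ ≤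
      8 * σv * Real.sqrt (p * (2 * ((dy + (LTI.rolloutLength m p q : ℝ) * du) * Real.log 9 +
        Real.log (2 / δ)))) / (σu * Real.sqrt M) := by
    refine (LTI.norm_hankel_sub_hankelOfMarkov_le A B C m p q Φhat).trans
      ((mul_le_mul_of_nonneg_left (hLS ω hω Φhat hΦ) (Real.sqrt_nonneg _)).trans_eq ?_)
    rw [Real.sqrt_mul (Nat.cast_nonneg p)]
    ring
  -- Strictness normally comes from the noise level being strictly below `ε̂`. If `du + dy = 0`,
  -- then `ε̂ = 0` but the matrices are empty, and strictness comes from `ε̃ > 0`.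
  have hstrict : ‖LTI.hankel A B C m p q - LTI.hankelOfMarkov m p q Φhat‖ ≤
        LTI.epsHat σu σv du dy m p q M δ ∧
      ‖LTI.hankel A B C m p q - LTI.hankelOfMarkov m p q Φhat‖ +
          ‖LTI.hankel A B C m p q - LTI.hankelTilde (C * Q₁) N₁ (R₁ * B) m p q‖ <
        LTI.epsHat σu σv du dy m p q M δ + LTI.epsTilde L ‖lam ⟨k, hkn⟩‖ m p q := by
    rcases Nat.eq_zero_or_pos (du + dy) with hS | hS
    · have hdy : dy = 0 := by omega
      subst hdy
      have hzero : ∀ X : Matrix (Fin p × Fin 0) (Fin q × Fin du) ℝ, ‖X‖ = 0 := fun X => by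
        rw [Subsingleton.elim X 0, norm_zero]
      have heps : 0 ≤ LTI.epsHat σu σv du 0 m p q M δ := by
        rw [LTI.epsHat]
        positivity
      -- The stable block is nonempty since `k < n`, so `0 < ‖N₂ ^ 0‖ ≤ L`.
      have hL : 0 < L := by
        have : Nonempty (Fin (n - k)) := ⟨⟨0, by omega⟩⟩
        have h := hN₂ 0
        rw [pow_zero, pow_zero, mul_one] at h
        exact (norm_pos_iff.2 one_ne_zero).trans_le h
      have heps' : 0 < LTI.epsTilde L ‖lam ⟨k, hkn⟩‖ m p q := by
        rw [LTI.epsTilde]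
        have : (0 : ℝ) < p := by exact_mod_cast hp
        have : (0 : ℝ) < q := by exact_mod_cast hq
        positivity
      rw [hzero, hzero]
      exact ⟨heps, by linarith⟩
    · have hlt : ‖LTI.hankel A B C m p q - LTI.hankelOfMarkov m p q Φhat‖ <
          LTI.epsHat σu σv du dy m p q M δ := by
        refine hle.trans_lt ?_
        have h9 : 0 < Real.log 9 := Real.log_pos (by norm_num)
        rw [LTI.epsHat]
        have hnl := LTI.noise_level_lt (m := m) hp hq hS hδ₀ hδ₁
        have hsq := Real.sqrt_lt_sqrt (by positivity) hnl
        gcongr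
      exact ⟨hlt.le, add_lt_add_of_lt_of_le hlt hdet⟩
  refine ⟨hstrict.1, fun Hhat hH => ?_⟩
  have h1 := hH.norm_sub_le (LTI.obsTilde (C * Q₁) N₁ m p) (LTI.conTilde N₁ (R₁ * B) m q)
  change ‖Hhat - LTI.hankelOfMarkov m p q Φhat‖ ≤ ‖LTI.hankelOfMarkov m p q Φhat -
    LTI.hankelTilde (C * Q₁) N₁ (R₁ * B) m p q‖ at h1
  have h2 := norm_sub_le_norm_sub_add_norm_sub Hhat (LTI.hankelOfMarkov m p q Φhat)
    (LTI.hankelTilde (C * Q₁) N₁ (R₁ * B) m p q)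
  have h3 := norm_sub_le_norm_sub_add_norm_sub (LTI.hankelOfMarkov m p q Φhat)
    (LTI.hankel A B C m p q) (LTI.hankelTilde (C * Q₁) N₁ (R₁ * B) m p q)
  rw [norm_sub_rev (LTI.hankelOfMarkov m p q Φhat) (LTI.hankel A B C m p q)] at h3
  linarith [hstrict.2]
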